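/- Let $q,t$ be independent indeterminates, $\mathbb{F}=\mathbb{Q}(q,t)$, and let $\Lambda_{\mathbb F}$ be the ring of symmetric functions over $\mathbb F$, with power sums $p_\lambda$ and monomial symmetric functions $m_\lambda$. Let $\langle p_\lambda,p_\mu\rangle=\delta_{\lambda\mu}\prod_{i\ge1}i^{m_i}m_i!\prod_j\frac{1-q^{\lambda_j}}{1-t^{\lambda_j}}$ (with $m_i$ the number of parts of $\lambda$ equal to $i$) be Macdonald's scalar product, $P_\lambda(x;q,t)$ the Macdonald symmetric functions (unitriangular in the $m_\mu$ for the dominance order, and pairwise orthogonal), and $Q_\lambda=\langle P_\lambda,P_\lambda\rangle^{-1}P_\lambda$. Define $g_n$ by $\prod_i\frac{(tx_iy;q)_\infty}{(x_iy;q)_\infty}=\sum_{n\ge0}g_n(x;q,t)\,y^n$, set $g_\mu=g_{\mu_1}g_{\mu_2}\cdots$, and let $P_\lambda=\sum_\mu c_{\lambda\mu}\,g_\mu$ be the expansion of $P_\lambda$ in the basis $\{g_\mu\}$. Let $\omega(z,w)=\frac{(z-q^{-1}w)(z-tw)(z-qt^{-1}w)}{(z-w)^3}$. For rational functions $f$ in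 $k$ variables and $h$ in $l$ variables over $\mathbb F$, let $$(f*h)(z_1,\dots,z_{k+l})=\operatorname{Sym}\Big[f(z_1,\dots,z_k)\,h(z_{k+1},\dots,z_{k+l})\prod_{1\le\alpha\le k<\beta\le k+l}\omega(z_\alpha,z_\beta)\Big],$$ where $\operatorname{Sym}$ is the average over all permutations of the variables. Let $\epsilon_r(z_1,\dots,z_r;t)=\prod_{1\le i<j\le r}\frac{(z_i-tz_j)(z_i-t^{-1}z_j)}{(z_i-z_j)^2}$ and $\epsilon_\mu=\epsilon_{\mu_1}*\epsilon_{\mu_2}*\cdots$. For a partition $\lambda$ of $n$ put $$F_\lambda(z;q,t)=\frac{(-1)^n}{(1-q)^n\,n!}\sum_{\mu\vdash n}c_{\lambda\mu}\,\epsilon_\mu(z;t)\,\frac{n!}{\prod_i\mu_i!},\qquad K_n(x,z;q,t)=\sum_{\lambda\vdash n}Q_\lambda(x)\,F_\lambda(z;q,t).$$ Then for all $m,n\ge0$, after restriction to finitely many variables $x=(x_1,\dots,x_m)$, and with $z=(z_1,\dots,z_n)$, $$K_n(x,z;q,t)=\frac{(-1)^n}{(1-q)^n\,n!}\sum_{i_1=1}^m\cdots\sum_{i_n=1}^m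 x_{i_1}\cdots x_{i_n}\prod_{1\le\alpha<\beta\le n}\gamma_{i_\alpha,i_\beta}(z_\alpha,z_\beta;q,t),$$ where $$\gamma_{i,j}(z,w;q,t)=\begin{cases}\dfrac{(z-tw)(z-t^{-1}w)}{(z-w)^2}&i=j,\\[2mm]\dfrac{(z-q^{-1}w)(z-tw)(z-qt^{-1}w)}{(z-w)^3}&i<j,\\[2mm]\dfrac{(z-qw)(z-t^{-1}w)(z-q^{-1}tw)}{(z-w)^3}&i>j.\end{cases}$$ -/

import Mathlib

noncomputable section

namespace MacdonaldKernel

/-- Symmetric functions that are homogeneous of degree `n`: formal power series in the variables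
`x_0, x_1, x_2, …`, homogeneous of degree `n`, invariant under all permutations of the
variables. This is the degree `n` part of the ring of symmetric functions over `K`. -/
def SymFun (K : Type*) [Field K] (n : ℕ) : Submodule K (MvPowerSeries ℕ K) where
  carrier := {f | f.IsHomogeneous n ∧ ∀ σ : Equiv.Perm ℕ, MvPowerSeries.renameEquiv K σ f = f}
  add_mem' hf hg := ⟨MvPowerSeries.IsHomogeneous.add hf.1 hg.1, fun σ => by rw [map_add, hf.2 σ, hg.2 σ]⟩
  zero_mem' := ⟨fun h => absurd (map_zero _) h, fun σ => map_zero _⟩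
  smul_mem' c f hf := ⟨fun {d} h => hf.1 fun h0 => h (by simp [h0]),
    fun σ => by rw [map_smul, hf.2 σ]⟩

/-- The multiset of the nonzero exponents of the monomial `x^d`. -/
def expType (d : ℕ →₀ ℕ) : Multiset ℕ := d.support.val.map d

theorem coeff_rename_perm {K : Type*} [CommSemiring K] (σ : Equiv.Perm ℕ) (f : MvPowerSeries ℕ K)
    (d : ℕ →₀ ℕ) :
    (MvPowerSeries.renameEquiv K σ f).coeff d = f.coeff (d.embDomain σ.symm.toEmbedding) := by
  have h := MvPowerSeries.coeff_embDomain_rename σ.toEmbedding f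
    (d.embDomain σ.symm.toEmbedding)
  rw [← h]
  have : (d.embDomain σ.symm.toEmbedding).embDomain σ.toEmbedding = d := by
    ext i
    have h1 := Finsupp.embDomain_apply_self σ.toEmbedding
      (d.embDomain σ.symm.toEmbedding) (σ.symm i)
    have h2 := Finsupp.embDomain_apply_self σ.symm.toEmbedding d i
    simp only [Equiv.coe_toEmbedding, Equiv.apply_symm_apply] at h1 h2
    rw [h1, h2]
  rw [this]
  rfl

theorem expType_embDomain (σ : ℕ ↪ ℕ) (d : ℕ →₀ ℕ) : expType (d.embDomain σ) = expType d := by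
  simp [expType, Finsupp.support_embDomain, Finset.map_val, Multiset.map_map]

theorem expType_sum (d : ℕ →₀ ℕ) : (expType d).sum = d.degree := rfl

theorem expType_pos {d : ℕ →₀ ℕ} {i : ℕ} (h : i ∈ expType d) : 0 < i := by
  simp only [expType, Multiset.mem_map, Finset.mem_val, Finsupp.mem_support_iff] at h
  obtain ⟨j, hj, rfl⟩ := h
  omega

theorem degree_eq_of_expType {n : ℕ} {d : ℕ →₀ ℕ} {p : n.Partition} (h : expType d = p.parts) :
    d.degree = n := by
  rw [← expType_sum, h, p.parts_sum]

theorem exists_perm_of_expType_eq {d e : ℕ →₀ ℕ} (h : expType d = expType e) :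
    ∃ σ : Equiv.Perm ℕ, e = d.embDomain σ.toEmbedding := by
  classical
  have hc : ∀ v, Nonempty ({x : d.support // d x = v} ≃ {x : e.support // e x = v}) := by
    intro v
    have key : ∀ f : ℕ →₀ ℕ, Fintype.card {x : f.support // f x = v} = (expType f).count v := by
      intro f
      rw [expType, Multiset.count_map, Fintype.card_subtype]
      have : (Finset.univ.filter fun x : f.support => f x = v).map (Function.Embedding.subtype _) =
          f.support.filter fun x => v = f x := by
        ext x; simp [eq_comm, and_comm]
      rw [← Finset.card_map (Function.Embedding.subtype _), this]; rfl
    exact ⟨Fintype.equivOfCardEq (by rw [key, key, h])⟩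
  let E : d.support ≃ e.support :=
    (Equiv.sigmaFiberEquiv (fun x : d.support => d x)).symm.trans
      ((Equiv.sigmaCongrRight fun v => (hc v).some).trans
        (Equiv.sigmaFiberEquiv (fun x : e.support => e x)))
  have hE : ∀ x, e (E x) = d x := fun x => ((hc (d x)).some ⟨x, rfl⟩).2
  have (f : ℕ →₀ ℕ) : Infinite {x // ¬ x ∈ f.support} :=
    (Set.Finite.infinite_compl f.support.finite_toSet).to_subtype
  let E' : {x // ¬ x ∈ d.support} ≃ {x // ¬ x ∈ e.support} := Classical.choice inferInstance
  refine ⟨Equiv.subtypeCongr E E', ?_⟩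
  have main : ∀ x, e (Equiv.subtypeCongr E E' x) = d x := by
    intro x
    by_cases hx : x ∈ d.support
    · rw [← hE ⟨x, hx⟩]
      simp [Equiv.subtypeCongr, Equiv.sumCompl_symm_apply_of_pos hx]
    · have h2 := (E' ⟨x, hx⟩).2
      have : Equiv.subtypeCongr E E' x = E' ⟨x, hx⟩ := by
        simp [Equiv.subtypeCongr, Equiv.sumCompl_symm_apply_of_neg hx]
      rw [this]
      rw [Finsupp.notMem_support_iff] at h2 hx
      rw [h2, hx]
  ext y
  obtain ⟨x, rfl⟩ := (Equiv.subtypeCongr E E').surjective y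
  rw [main]
  exact (Finsupp.embDomain_apply_self (Equiv.subtypeCongr E E').toEmbedding d x).symm

theorem exists_expType_eq {n : ℕ} (p : n.Partition) : ∃ d, expType d = p.parts := by
  have key : ∀ s : Multiset ℕ, (∀ i ∈ s, 0 < i) → ∃ d, expType d = s := by
    intro s
    induction s using Multiset.induction with
    | empty => exact fun _ => ⟨0, by simp [expType]⟩
    | cons a s ih =>
      intro h
      obtain ⟨d, hd⟩ := ih fun i hi => h i (Multiset.mem_cons_of_mem hi)
      obtain ⟨j, hj⟩ := Infinite.exists_notMem_finset d.support
      have ha := h a (Multiset.mem_cons_self _ _)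
      refine ⟨d + Finsupp.single j a, ?_⟩
      have hs : (d + Finsupp.single j a).support = Finset.cons j d.support hj := by
        ext x
        rcases eq_or_ne x j with rfl | hx
        · simp; omega
        · simp [hx]
      rw [expType, hs, Finset.cons_val, Multiset.map_cons, ← hd]
      have hj0 := Finsupp.notMem_support_iff.1 hj
      congr 1
      · simp [hj0]
      · refine Multiset.map_congr rfl fun x hx => ?_
        have : x ≠ j := fun h => hj (h ▸ hx)
        simp [this]
  exact key p.parts fun i hi => p.parts_pos hi

/-- The coefficients of a symmetric function depend only on the type of the monomial. -/
theorem coeff_eq_of_expType {K : Type*} [Field K] {n : ℕ} (f : SymFun K n) {d e : ℕ →₀ ℕ}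
    (h : expType d = expType e) : (f : MvPowerSeries ℕ K).coeff d = (f : MvPowerSeries ℕ K).coeff e := by
  obtain ⟨σ, rfl⟩ := exists_perm_of_expType_eq h
  conv_rhs => rw [← f.2.2 σ]
  rw [coeff_rename_perm]
  congr 2
  ext i
  have h1 := Finsupp.embDomain_apply_self σ.symm.toEmbedding (d.embDomain σ.toEmbedding) (σ i)
  have h2 := Finsupp.embDomain_apply_self σ.toEmbedding d i
  simp only [Equiv.coe_toEmbedding, Equiv.symm_apply_apply] at h1 h2
  rw [h1, h2]

theorem mem_SymFun_of_coeff {K : Type*} [Field K] {n : ℕ} (f : MvPowerSeries ℕ K)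
    (h1 : ∀ d : ℕ →₀ ℕ, d.degree ≠ n → f.coeff d = 0)
    (h2 : ∀ d e : ℕ →₀ ℕ, expType d = expType e → f.coeff d = f.coeff e) : f ∈ SymFun K n := by
  constructor
  · intro d hd
    by_contra h
    apply hd
    apply h1
    rwa [Finsupp.degree_eq_weight_one]
  · intro σ
    ext d
    rw [coeff_rename_perm]
    exact h2 _ _ (expType_embDomain _ _)

/-- The power series whose coefficient at `x^d` is `c d`. -/
def ofCoeff {K : Type*} [Semiring K] (c : (ℕ →₀ ℕ) → K) : MvPowerSeries ℕ K := c

theorem coeff_ofCoeff {K : Type*} [Semiring K] (c : (ℕ →₀ ℕ) → K) (d : ℕ →₀ ℕ) :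
    (ofCoeff c).coeff d = c d := rfl

/-- The monomial symmetric function `m_λ`: the sum of all monomials `x^d` such that the nonzero
exponents in `d` are the parts of `λ`. -/
def mono (K : Type*) [Field K] {n : ℕ} (p : n.Partition) : SymFun K n :=
  ⟨ofCoeff fun d => if expType d = p.parts then 1 else 0, by
    apply mem_SymFun_of_coeff
    · intro d hd
      rw [coeff_ofCoeff, if_neg fun h => hd (degree_eq_of_expType h)]
    · intro d e h
      rw [coeff_ofCoeff, coeff_ofCoeff, h]⟩

theorem coeff_mono {K : Type*} [Field K] {n : ℕ} (p : n.Partition) (d : ℕ →₀ ℕ) :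
    (mono K p : MvPowerSeries ℕ K).coeff d = if expType d = p.parts then 1 else 0 := rfl

theorem SymFun.ext_coeff {K : Type*} [Field K] {n : ℕ} {f g : SymFun K n}
    (h : ∀ d : ℕ →₀ ℕ, d.degree = n →
      (f : MvPowerSeries ℕ K).coeff d = (g : MvPowerSeries ℕ K).coeff d) : f = g := by
  apply Subtype.ext
  ext d
  by_cases hd : d.degree = n
  · exact h d hd
  · rw [MvPowerSeries.IsHomogeneous.coeff_eq_zero f.2.1 hd,
      MvPowerSeries.IsHomogeneous.coeff_eq_zero g.2.1 hd]

/-- The `m_λ`, `λ ⊢ n`, form a basis of the symmetric functions of degree `n`. -/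
def monoBasis (K : Type*) [Field K] (n : ℕ) : Module.Basis n.Partition K (SymFun K n) :=
  Module.Basis.ofEquivFun
    { toFun := fun f p => (f : MvPowerSeries ℕ K).coeff (exists_expType_eq p).choose
      map_add' := fun f g => by ext p; simp
      map_smul' := fun c f => by ext p; simp
      invFun := fun c => ∑ p, c p • mono K p
      left_inv := by
        intro f
        apply SymFun.ext_coeff
        intro d hd
        let p : n.Partition := ⟨expType d, expType_pos, by rw [expType_sum, hd]⟩
        simp only [Submodule.coe_sum, Submodule.coe_smul, map_sum, map_smul, coeff_mono,
          smul_eq_mul, mul_ite, mul_one, mul_zero]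
        rw [Finset.sum_eq_single p]
        · rw [if_pos rfl]
          exact coeff_eq_of_expType f (exists_expType_eq p).choose_spec
        · intro r _ hr
          rw [if_neg fun h => hr (Nat.Partition.ext h.symm)]
        · simp
      right_inv := by
        intro c
        ext p
        simp only [Submodule.coe_sum, Submodule.coe_smul, map_sum, map_smul, coeff_mono,
          smul_eq_mul, mul_ite, mul_one, mul_zero, (exists_expType_eq p).choose_spec]
        rw [Finset.sum_eq_single p]
        · simp
        · intro r _ hr
          rw [if_neg fun h => hr (Nat.Partition.ext h.symm)]
        · simp }

theorem monoBasis_apply {K : Type*} [Field K] {n : ℕ} (p : n.Partition) :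
    monoBasis K n p = mono K p := by
  classical
  have h : monoBasis K n p =
      ∑ r, (Finsupp.single p (1 : K) : n.Partition →₀ K) r • mono K r := rfl
  rw [h, Finset.sum_eq_single p]
  · simp
  · intro r _ hr
    simp [hr.symm]
  · simp

theorem SymFun.one_mem (K : Type*) [Field K] : (1 : MvPowerSeries ℕ K) ∈ SymFun K 0 := by
  classical
  refine ⟨fun {d} hd => ?_, fun σ => map_one _⟩
  rw [MvPowerSeries.coeff_one] at hd
  have : d = 0 := by by_contra h; exact hd (if_neg h)
  simp [this]

theorem SymFun.mul_mem {K : Type*} [Field K] {a b : ℕ} {f g : MvPowerSeries ℕ K}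
    (hf : f ∈ SymFun K a) (hg : g ∈ SymFun K b) : f * g ∈ SymFun K (a + b) :=
  ⟨MvPowerSeries.IsHomogeneous.mul hf.1 hg.1, fun σ => by rw [map_mul, hf.2 σ, hg.2 σ]⟩

theorem SymFun.prod_mem {K : Type*} [Field K] {F : ℕ → MvPowerSeries ℕ K}
    (hF : ∀ k, F k ∈ SymFun K k) (s : Multiset ℕ) : (s.map F).prod ∈ SymFun K s.sum := by
  induction s using Multiset.induction with
  | empty => simpa using SymFun.one_mem K
  | cons a s ih => simpa using SymFun.mul_mem (hF a) ih

/-- For a sequence `F 0, F 1, …` of symmetric functions with `F k` of degree `k`, the product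
`F_λ = F (λ_1) * F (λ_2) * ⋯` over the parts of the partition `λ`. -/
def symProd {K : Type*} [Field K] (F : (k : ℕ) → SymFun K k) {n : ℕ} (p : n.Partition) : SymFun K n :=
  ⟨(p.parts.map fun k => (F k : MvPowerSeries ℕ K)).prod, by
    have h := SymFun.prod_mem (fun k => (F k).2) p.parts
    rwa [p.parts_sum] at h⟩

open Classical in
/-- The power sum `∑ i, x_i ^ k` (for `k ≥ 1`) as a formal power series. -/
def powerSumSeries (R : Type*) [Semiring R] (k : ℕ) : MvPowerSeries ℕ R :=
  ofCoeff fun d => if ∃ i, d = Finsupp.single i k then 1 else 0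

theorem expType_single (i : ℕ) {k : ℕ} (hk : k ≠ 0) : expType (Finsupp.single i k) = {k} := by
  simp [expType, Finsupp.support_single_ne_zero i hk]

/-- The power sum symmetric function `p_k`. -/
def powerSum (K : Type*) [Field K] (k : ℕ) : SymFun K k :=
  ⟨powerSumSeries K k, by
    classical
    apply mem_SymFun_of_coeff
    · intro d hd
      rw [powerSumSeries, coeff_ofCoeff, if_neg]
      rintro ⟨i, rfl⟩
      exact hd (by simp)
    · intro d e h
      obtain ⟨σ, rfl⟩ := exists_perm_of_expType_eq h
      rw [powerSumSeries, coeff_ofCoeff, coeff_ofCoeff]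
      congr 1
      apply propext
      constructor
      · rintro ⟨i, rfl⟩
        exact ⟨σ i, by simp⟩
      · rintro ⟨i, hi⟩
        refine ⟨σ.symm i, ?_⟩
        apply Finsupp.embDomain_injective σ.toEmbedding
        rw [hi]
        simp⟩

/-- The power sum product `p_λ = p_{λ_1} p_{λ_2} ⋯`. -/
def powerSumProd (K : Type*) [Field K] {n : ℕ} (p : n.Partition) : SymFun K n :=
  symProd (powerSum K) p

theorem powerSumSeries_map (K : Type*) [Field K] (s : Multiset ℕ) :
    (s.map (powerSumSeries K)).prod =
      MvPowerSeries.map (Nat.castRingHom K) (s.map (powerSumSeries ℕ)).prod := by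
  classical
  rw [map_multiset_prod, Multiset.map_map]
  congr 2
  funext k
  ext d
  simp only [Function.comp_apply, MvPowerSeries.coeff_map]
  simp only [powerSumSeries, coeff_ofCoeff]
  split_ifs <;> simp

theorem expType_add_single {d : ℕ →₀ ℕ} {i k : ℕ} (hi : i ∉ d.support) (hk : k ≠ 0) :
    expType (Finsupp.single i k + d) = k ::ₘ expType d := by
  classical
  have hd : Disjoint (Finsupp.single i k).support d.support := by
    rw [Finsupp.support_single_ne_zero i hk]; simpa using hi
  have hs : (Finsupp.single i k + d).support = Finset.cons i d.support hi := by
    rw [Finsupp.support_add_eq hd, Finsupp.support_single_ne_zero i hk]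
    ext; simp
  have hi0 := Finsupp.notMem_support_iff.1 hi
  rw [expType, hs, Finset.cons_val, Multiset.map_cons]
  congr 1
  · simp [hi0]
  · refine Multiset.map_congr rfl fun x hx => ?_
    have : x ≠ i := fun h => hi (h ▸ hx)
    simp [this.symm]

theorem powerSumSeries_coeff_le (s : Multiset ℕ) (hs : ∀ k ∈ s, 0 < k) (d : ℕ →₀ ℕ)
    (h : (s.map (powerSumSeries ℕ)).prod.coeff d ≠ 0) :
    (expType d).card < s.card ∨ expType d = s := by
  classical
  induction s using Multiset.induction generalizing d with
  | empty =>
    rw [Multiset.map_zero, Multiset.prod_zero, MvPowerSeries.coeff_one] at h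
    have : d = 0 := by by_contra h'; exact h (if_neg h')
    right; simp [this, expType]
  | cons k s ih =>
    rw [Multiset.map_cons, Multiset.prod_cons, MvPowerSeries.coeff_mul] at h
    obtain ⟨⟨a, b⟩, hab, hne⟩ := Finset.exists_ne_zero_of_sum_ne_zero h
    rw [Finset.HasAntidiagonal.mem_antidiagonal] at hab
    have h1 := left_ne_zero_of_mul hne
    have h2 := right_ne_zero_of_mul hne
    rw [powerSumSeries, coeff_ofCoeff] at h1
    have hk := hs k (Multiset.mem_cons_self _ _)
    obtain ⟨i, rfl⟩ : ∃ i, a = Finsupp.single i k := by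
      by_contra h'; exact h1 (if_neg h')
    have ih' := ih (fun j hj => hs j (Multiset.mem_cons_of_mem hj)) b h2
    simp only at hab
    subst hab
    by_cases hi : i ∈ b.support
    · left
      have hsub : (Finsupp.single i k + b).support ⊆ b.support := by
        refine Finsupp.support_add.trans (Finset.union_subset ?_ subset_rfl)
        rw [Finsupp.support_single_ne_zero i hk.ne']
        simpa using hi
      have hle : (expType (Finsupp.single i k + b)).card ≤ (expType b).card := by
        simpa [expType] using Finset.card_le_card hsub
      have : (expType b).card ≤ s.card := by
        rcases ih' with h | h
        · exact h.le
        · rw [h]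
      rw [Multiset.card_cons]; omega
    · rw [expType_add_single hi hk.ne', Multiset.card_cons, Multiset.card_cons]
      rcases ih' with h | h
      · left; omega
      · right; rw [h]

theorem powerSumSeries_coeff_ne_zero (s : Multiset ℕ) (hs : ∀ k ∈ s, 0 < k) (d : ℕ →₀ ℕ)
    (h : expType d = s) : (s.map (powerSumSeries ℕ)).prod.coeff d ≠ 0 := by
  classical
  induction s using Multiset.induction generalizing d with
  | empty =>
    have : d = 0 := by simpa [expType] using h
    simp [this]
  | cons k s ih =>
    have hk := hs k (Multiset.mem_cons_self _ _)
    obtain ⟨i, hi, rfl⟩ : ∃ i ∈ d.support, d i = k := by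
      have : k ∈ expType d := h ▸ Multiset.mem_cons_self _ _
      simpa [expType] using this
    have hd : Finsupp.single i (d i) + d.erase i = d := Finsupp.single_add_erase i d
    have hi' : i ∉ (d.erase i).support := by simp
    have h2 : expType (d.erase i) = s := by
      have := expType_add_single hi' hk.ne'
      rw [hd, h] at this
      exact ((Multiset.cons_inj_right _).1 this).symm
    rw [Multiset.map_cons, Multiset.prod_cons, MvPowerSeries.coeff_mul]
    intro h0
    rw [Finset.sum_eq_zero_iff] at h0
    have := h0 (Finsupp.single i (d i), d.erase i) (by rw [Finset.HasAntidiagonal.mem_antidiagonal, hd])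
    rw [Nat.mul_eq_zero] at this
    rcases this with h3 | h3
    · rw [powerSumSeries, coeff_ofCoeff, if_pos ⟨i, rfl⟩] at h3
      exact one_ne_zero h3
    · exact ih (fun j hj => hs j (Multiset.mem_cons_of_mem hj)) _ h2 h3

theorem coeff_powerSumProd (K : Type*) [Field K] {n : ℕ} (p : n.Partition) (d : ℕ →₀ ℕ) :
    (powerSumProd K p : MvPowerSeries ℕ K).coeff d =
      (((p.parts.map (powerSumSeries ℕ)).prod.coeff d : ℕ) : K) := by
  have : (powerSumProd K p : MvPowerSeries ℕ K) = (p.parts.map (powerSumSeries K)).prod := rfl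
  rw [this, powerSumSeries_map, MvPowerSeries.coeff_map]
  rfl

theorem powerSumProd_linearIndependent (K : Type*) [Field K] [CharZero K] (n : ℕ) :
    LinearIndependent K (powerSumProd K (n := n)) := by
  classical
  rw [Fintype.linearIndependent_iff]
  intro c hc
  by_contra! hne
  obtain ⟨p, hp, hmax⟩ := Finset.exists_max_image
    (Finset.univ.filter fun p : n.Partition => c p ≠ 0) (fun p => p.parts.card)
    (by obtain ⟨i, hi⟩ := hne; exact ⟨i, by simpa using hi⟩)
  obtain ⟨d, hd⟩ := exists_expType_eq p
  have h := congrArg (fun f : SymFun K n => (f : MvPowerSeries ℕ K).coeff d) hc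
  simp only [Submodule.coe_sum, Submodule.coe_smul, map_sum, map_smul, smul_eq_mul,
    Submodule.coe_zero, map_zero] at h
  rw [Finset.sum_eq_single p] at h
  · rw [coeff_powerSumProd] at h
    rcases mul_eq_zero.1 h with h | h
    · simp at hp; exact hp h
    · exact powerSumSeries_coeff_ne_zero p.parts (fun k hk => p.parts_pos hk) d hd
        (by exact_mod_cast h)
  · intro r _ hr
    by_contra h0
    have hcr := left_ne_zero_of_mul h0
    have hr0 := right_ne_zero_of_mul h0
    rw [coeff_powerSumProd, Nat.cast_ne_zero] at hr0
    have hle := hmax r (by simpa using hcr)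
    rcases powerSumSeries_coeff_le r.parts (fun k hk => r.parts_pos hk) d hr0 with h1 | h1
    · rw [hd] at h1; omega
    · exact hr (Nat.Partition.ext (h1.symm.trans hd))
  · simp

/-- The `p_λ`, `λ ⊢ n`, form a basis of the symmetric functions of degree `n`. -/
def powerSumBasis (K : Type*) [Field K] [CharZero K] (n : ℕ) :
    Module.Basis n.Partition K (SymFun K n) :=
  haveI : FiniteDimensional K (SymFun K n) := Module.Basis.finiteDimensional_of_finite (monoBasis K n)
  haveI : Nonempty n.Partition := ⟨Nat.Partition.indiscrete n⟩
  basisOfLinearIndependentOfCardEqFinrank (powerSumProd_linearIndependent K n)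
    (Module.finrank_eq_card_basis (monoBasis K n)).symm

theorem powerSumBasis_apply {K : Type*} [Field K] [CharZero K] {n : ℕ} (p : n.Partition) :
    powerSumBasis K n p = powerSumProd K p := by
  simp [powerSumBasis]

/-- The parts of a partition in decreasing order, `λ_1 ≥ λ_2 ≥ ⋯`. -/
def partList {n : ℕ} (p : n.Partition) : List ℕ := p.parts.sort (· ≥ ·)

theorem partList_coe {n : ℕ} (p : n.Partition) : (partList p : Multiset ℕ) = p.parts :=
  Multiset.sort_eq _ _

theorem partList_sum {n : ℕ} (p : n.Partition) : (partList p).sum = n := by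
  rw [← Multiset.sum_coe, partList_coe, p.parts_sum]

theorem partList_pos {n : ℕ} {p : n.Partition} {i : ℕ} (h : i ∈ partList p) : 0 < i :=
  p.parts_pos (by rwa [← Multiset.mem_coe, partList_coe] at h)

theorem partList_injective {n : ℕ} : Function.Injective (partList (n := n)) := by
  intro p r h
  apply Nat.Partition.ext
  rw [← partList_coe, h, partList_coe]

/-- Strict dominance order: `r < p`. -/
def DomLT {n : ℕ} (r p : n.Partition) : Prop :=
  (∀ i, ((partList r).take i).sum ≤ ((partList p).take i).sum) ∧ r ≠ p

/-- Strict lexicographic order of partitions, a total order that refines the dominance order. -/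
def LexLT {n : ℕ} (r p : n.Partition) : Prop := partList r < partList p

instance {n : ℕ} (p : n.Partition) : DecidablePred fun r : n.Partition => LexLT r p :=
  fun _ => inferInstanceAs (Decidable (_ < _))

theorem DomLT.lexLT {n : ℕ} {r p : n.Partition} (h : DomLT r p) : LexLT r p := by
  rcases lt_trichotomy (partList r) (partList p) with h1 | h1 | h1
  · exact h1
  · exact absurd (partList_injective h1) h.2
  · exfalso
    rcases List.lt_iff_exists.1 h1 with ⟨h2, h3⟩ | ⟨i, hi1, hi2, h2, h3⟩
    · have hs : (partList r).sum = (partList p).sum + ((partList r).drop (partList p).length).sum := by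
        conv_lhs => rw [← List.take_append_drop (partList p).length (partList r)]
        rw [List.sum_append, ← h2]
      rw [partList_sum, partList_sum] at hs
      have hlt : 0 < ((partList r).drop (partList p).length).length := by
        rw [List.length_drop]; omega
      have hmem := List.getElem_mem hlt
      have := partList_pos (List.mem_of_mem_drop hmem)
      have := List.single_le_sum (fun _ _ => Nat.zero_le _) _ hmem
      omega
    · have hle := h.1 (i + 1)
      rw [List.take_succ_eq_append_getElem hi2, List.take_succ_eq_append_getElem hi1,
        List.sum_append, List.sum_append] at hle
      have : (partList r).take i = (partList p).take i := by
        apply List.ext_getElem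
        · simp; omega
        · intro j hj1 hj2
          simp only [List.length_take] at hj1
          rw [List.getElem_take, List.getElem_take]
          exact (h2 j (by omega)).symm
      rw [this] at hle
      simp at hle
      omega

theorem lexLT_wf (n : ℕ) : WellFounded (LexLT (n := n)) :=
  haveI : IsTrans n.Partition LexLT := ⟨fun _ _ _ h1 h2 => lt_trans (α := List ℕ) h1 h2⟩
  haveI : Std.Irrefl (LexLT (n := n)) := ⟨fun p => lt_irrefl (partList p)⟩
  Finite.wellFounded_of_trans_of_irrefl LexLT

/-- `∏_{i ≥ 1} i ^ m_i m_i! * ∏_j (1 - q ^ λ_j) / (1 - t ^ λ_j)`, where `m_i` is the number of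
parts of `λ` equal to `i`. -/
def zqt {K : Type*} [Field K] (q t : K) {n : ℕ} (p : n.Partition) : K :=
  (∏ i ∈ p.parts.toFinset, (i : K) ^ p.parts.count i * ((p.parts.count i).factorial : K)) *
    (p.parts.map fun k => (1 - q ^ k) / (1 - t ^ k)).prod

/-- Macdonald's scalar product on symmetric functions of degree `n`: the bilinear form with
`⟨p_λ, p_μ⟩ = 0` for `λ ≠ μ` and `⟨p_λ, p_λ⟩ = zqt q t λ`. -/
def scalarProduct {K : Type*} [Field K] [CharZero K] (q t : K) (n : ℕ) :
    LinearMap.BilinForm K (SymFun K n) :=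
  Matrix.toBilin (powerSumBasis K n) (Matrix.diagonal (zqt q t))

theorem scalarProduct_powerSumProd {K : Type*} [Field K] [CharZero K] (q t : K) {n : ℕ}
    (p r : n.Partition) :
    scalarProduct q t n (powerSumProd K p) (powerSumProd K r) = if p = r then zqt q t p else 0 := by
  rw [← powerSumBasis_apply, ← powerSumBasis_apply, scalarProduct,
    ← LinearMap.BilinForm.toMatrix_apply, LinearMap.BilinForm.toMatrix_toBilin, Matrix.diagonal_apply]

/-- The Macdonald symmetric functions `P_λ(x;q,t)`, obtained from the monomial symmetric functions
`m_λ` by the Gram-Schmidt process for Macdonald's scalar product and the lexicographic order. -/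
def macdonaldP {K : Type*} [Field K] [CharZero K] (q t : K) (n : ℕ) : n.Partition → SymFun K n :=
  (lexLT_wf n).fix fun p P => mono K p - ∑ r : {r // LexLT r p},
    (scalarProduct q t n (mono K p) (P r r.2) / scalarProduct q t n (P r r.2) (P r r.2)) • P r r.2

theorem macdonaldP_eq {K : Type*} [Field K] [CharZero K] (q t : K) (n : ℕ) (p : n.Partition) :
    macdonaldP q t n p = mono K p - ∑ r ∈ Finset.univ.filter fun r => LexLT r p,
      (scalarProduct q t n (mono K p) (macdonaldP q t n r) /
        scalarProduct q t n (macdonaldP q t n r) (macdonaldP q t n r)) • macdonaldP q t n r := by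
  conv_lhs => rw [macdonaldP, WellFounded.fix_eq]
  congr 1
  rw [← Finset.sum_subtype_eq_sum_filter]
  simp only [Finset.subtype_univ]
  rfl

open Classical in
/-- The characterization of the Macdonald symmetric functions: unitriangularity with respect to
the dominance order, and orthogonality. -/
structure IsMacdonald {K : Type*} [Field K] [CharZero K] (q t : K) {n : ℕ}
    (P : n.Partition → SymFun K n) : Prop where
  triangular : ∀ p, ∃ a : n.Partition → K,
    P p = mono K p + ∑ r ∈ Finset.univ.filter fun r => DomLT r p, a r • mono K r
  orthogonal : ∀ p r, p ≠ r → scalarProduct q t n (P p) (P r) = 0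

theorem zqt_ne_zero {K : Type*} [Field K] [CharZero K] {q t : K} (hq : ∀ k, 0 < k → q ^ k ≠ 1)
    (ht : ∀ k, 0 < k → t ^ k ≠ 1) {n : ℕ} (p : n.Partition) : zqt q t p ≠ 0 := by
  refine mul_ne_zero (Finset.prod_ne_zero_iff.2 fun i hi => ?_) (Multiset.prod_ne_zero fun h => ?_)
  · have := p.parts_pos (Multiset.mem_toFinset.1 hi)
    exact mul_ne_zero (pow_ne_zero _ (Nat.cast_ne_zero.2 this.ne'))
      (Nat.cast_ne_zero.2 (Nat.factorial_ne_zero _))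
  · obtain ⟨k, hk, h0⟩ := Multiset.mem_map.1 h
    have := p.parts_pos hk
    exact div_ne_zero (sub_ne_zero.2 (hq k this).symm) (sub_ne_zero.2 (ht k this).symm) h0

theorem scalarProduct_nondegenerate {K : Type*} [Field K] [CharZero K] {q t : K}
    (hq : ∀ k, 0 < k → q ^ k ≠ 1) (ht : ∀ k, 0 < k → t ^ k ≠ 1) {n : ℕ} {f : SymFun K n}
    (h : ∀ g, scalarProduct q t n f g = 0) : f = 0 := by
  classical
  rw [← (powerSumBasis K n).sum_repr f]
  refine Finset.sum_eq_zero fun p _ => ?_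
  have := h (powerSumProd K p)
  rw [← (powerSumBasis K n).sum_repr f, map_sum, LinearMap.sum_apply,
    Finset.sum_eq_single p] at this
  · rw [map_smul, LinearMap.smul_apply, powerSumBasis_apply, scalarProduct_powerSumProd, if_pos rfl,
      smul_eq_mul] at this
    rw [(mul_eq_zero.1 this).resolve_right (zqt_ne_zero hq ht p), zero_smul]
  · intro r _ hr
    rw [map_smul, LinearMap.smul_apply, powerSumBasis_apply, scalarProduct_powerSumProd, if_neg hr,
      smul_zero]
  · simp

/-- The Gram-Schmidt construction is the only possible family of Macdonald symmetric functions. -/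
theorem IsMacdonald.eq_macdonaldP {K : Type*} [Field K] [CharZero K] {q t : K}
    (hq : ∀ k, 0 < k → q ^ k ≠ 1) (ht : ∀ k, 0 < k → t ^ k ≠ 1) {n : ℕ}
    {P : n.Partition → SymFun K n} (hP : IsMacdonald q t P) : P = macdonaldP q t n := by
  classical
  have tri : ∀ p, P p - mono K p ∈ Submodule.span K (mono K '' {r | LexLT r p}) := by
    intro p
    obtain ⟨a, ha⟩ := hP.triangular p
    rw [ha, add_sub_cancel_left]
    exact Submodule.sum_mem _ fun r hr => Submodule.smul_mem _ _
      (Submodule.subset_span ⟨r, (Finset.mem_filter.1 hr).2.lexLT, rfl⟩)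
  have inv : ∀ p, mono K p ∈ Submodule.span K (P '' {r | LexLT r p ∨ r = p}) := by
    intro p
    induction p using (lexLT_wf n).induction with
    | _ p ih =>
      have h1 : Submodule.span K (mono K '' {r | LexLT r p}) ≤
          Submodule.span K (P '' {r | LexLT r p ∨ r = p}) := by
        rw [Submodule.span_le]
        rintro _ ⟨r, hr, rfl⟩
        refine Submodule.span_mono (Set.image_mono ?_) (ih r hr)
        rintro s (hs | rfl)
        · exact Or.inl (lt_trans (α := List ℕ) hs hr)
        · exact Or.inl hr
      have h2 := Submodule.sub_mem _
        (Submodule.subset_span (Set.mem_image_of_mem P (Or.inr rfl : LexLT p p ∨ p = p)))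
        (h1 (tri p))
      simpa using h2
  have hspan : ∀ f : SymFun K n, f ∈ Submodule.span K (Set.range P) := by
    intro f
    rw [← (monoBasis K n).sum_repr f]
    refine Submodule.sum_mem _ fun p _ => Submodule.smul_mem _ _ ?_
    rw [monoBasis_apply]
    exact Submodule.span_mono (Set.image_subset_range _ _) (inv p)
  have hne0 : ∀ p, P p ≠ 0 := by
    intro p h0
    have h1 := tri p
    rw [h0, zero_sub, Submodule.neg_mem_iff] at h1
    have hm : ⇑(monoBasis K n) = mono K (n := n) := funext monoBasis_apply
    rw [← hm, Module.Basis.self_mem_span_image] at h1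
    exact lt_irrefl (partList p) h1
  have hiso : ∀ p, scalarProduct q t n (P p) (P p) ≠ 0 := by
    intro p h0
    apply hne0 p
    apply scalarProduct_nondegenerate hq ht
    intro g
    have := hspan g
    induction this using Submodule.span_induction with
    | mem x hx =>
      obtain ⟨r, rfl⟩ := hx
      rcases eq_or_ne p r with rfl | h
      · exact h0
      · exact hP.orthogonal p r h
    | zero => simp
    | add x y _ _ hx hy => rw [map_add, hx, hy, add_zero]
    | smul c x _ hx => rw [map_smul, hx, smul_zero]
  funext p
  induction p using (lexLT_wf n).induction with
  | _ p ih =>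
    have h1 : P p - mono K p ∈ Submodule.span K (P '' {r | LexLT r p}) := by
      refine (Submodule.span_le.2 ?_ : Submodule.span K (mono K '' {r | LexLT r p}) ≤ _) (tri p)
      rintro _ ⟨r, hr, rfl⟩
      refine Submodule.span_mono (Set.image_mono ?_) (inv r)
      rintro s (hs | rfl)
      · exact lt_trans (α := List ℕ) hs hr
      · exact hr
    have h1' : P p - mono K p ∈
        Submodule.span K (P '' ((Finset.univ.filter fun r => LexLT r p : Finset n.Partition) : Set n.Partition)) := by
      convert h1
      ext r
      simp
    rw [Submodule.mem_span_image_finset_iff_exists_fun] at h1'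
    obtain ⟨c₀, hc₀⟩ := h1'
    obtain ⟨c, hc⟩ : ∃ c : n.Partition → K,
        ∑ r ∈ Finset.univ.filter (fun r => LexLT r p), c r • P r = P p - mono K p := by
      refine ⟨fun r => if h : r ∈ Finset.univ.filter (fun r => LexLT r p) then c₀ ⟨r, h⟩ else 0, ?_⟩
      rw [← hc₀, ← Finset.sum_coe_sort]
      refine Finset.sum_congr rfl fun r _ => ?_
      exact congrArg (· • P r) (dif_pos r.2)

    have hPp : P p = mono K p + ∑ r ∈ Finset.univ.filter (fun r => LexLT r p), c r • P r := by
      rw [hc]; abel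
    have hcoef : ∀ r, LexLT r p → c r =
        -(scalarProduct q t n (mono K p) (P r) / scalarProduct q t n (P r) (P r)) := by
      intro r hr
      have hrp : p ≠ r := fun h => lt_irrefl (partList p) (by rw [← h] at hr; exact hr)
      have h0 := hP.orthogonal p r hrp
      rw [hPp, map_add, LinearMap.add_apply, map_sum, LinearMap.sum_apply,
        Finset.sum_eq_single r] at h0
      · rw [map_smul, LinearMap.smul_apply, smul_eq_mul] at h0
        rw [← neg_div, eq_div_iff (hiso r)]
        linear_combination h0
      · intro s _ hs
        rw [map_smul, LinearMap.smul_apply, hP.orthogonal s r hs, smul_zero]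
      · intro h; exact absurd (by simpa using hr) h
    rw [hPp, macdonaldP_eq, sub_eq_add_neg, ← Finset.sum_neg_distrib]
    congr 1
    refine Finset.sum_congr rfl fun r hr => ?_
    have hr' : LexLT r p := by simpa using hr
    rw [hcoef r hr', ih r hr']
    exact neg_smul (_ : K) (macdonaldP q t n r)

/-- The power series `(t u; q)_∞ / (u; q)_∞ = ∑_k (t; q)_k / (q; q)_k u ^ k` in `u`, where
`(a; q)_k = ∏_{0 ≤ i < k} (1 - a q ^ i)`. -/
def qBinomialSeries {K : Type*} [Field K] (q t : K) : PowerSeries K :=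
  PowerSeries.mk fun k => ∏ i ∈ Finset.range k, (1 - t * q ^ i) / (1 - q ^ (i + 1))

theorem qBinomialSeries_functional {K : Type*} [Field K] {q : K} (hq : ∀ k, 0 < k → q ^ k ≠ 1)
    (t : K) : (1 - PowerSeries.X) * qBinomialSeries q t =
      (1 - PowerSeries.C t * PowerSeries.X) * PowerSeries.rescale q (qBinomialSeries q t) := by
  ext k
  cases k with
  | zero =>
    simp only [sub_mul, one_mul, map_sub, mul_assoc, PowerSeries.coeff_C_mul,
      PowerSeries.coeff_zero_X_mul, PowerSeries.coeff_rescale]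
    simp
  | succ k =>
    have h : (1 : K) - q ^ (k + 1) ≠ 0 := sub_ne_zero.2 (hq _ k.succ_pos).symm
    simp only [sub_mul, one_mul, map_sub, PowerSeries.coeff_succ_X_mul, mul_assoc,
      PowerSeries.coeff_C_mul, PowerSeries.coeff_rescale, qBinomialSeries, PowerSeries.coeff_mk,
      Finset.prod_range_succ]
    field_simp
    ring

/-- The series `qBinomialSeries q t` is the infinite product `∏_{i ≥ 0} (1 - t q^i u) / (1 - q^i u)`:
its quotient by the partial product over `i < N` is its value at `q^N u`. -/
theorem qBinomialSeries_prod {K : Type*} [Field K] {q : K} (hq : ∀ k, 0 < k → q ^ k ≠ 1)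
    (t : K) (N : ℕ) :
    (∏ i ∈ Finset.range N, (1 - PowerSeries.C (q ^ i) * PowerSeries.X)) * qBinomialSeries q t =
      (∏ i ∈ Finset.range N, (1 - PowerSeries.C (t * q ^ i) * PowerSeries.X)) *
        PowerSeries.rescale (q ^ N) (qBinomialSeries q t) := by
  induction N with
  | zero => simp
  | succ N ih =>
    have h := congrArg (PowerSeries.rescale (q ^ N)) (qBinomialSeries_functional hq t)
    have hC : PowerSeries.rescale (q ^ N) (PowerSeries.C t) = PowerSeries.C t := by
      ext k; rw [PowerSeries.coeff_rescale, PowerSeries.coeff_C]; split_ifs with hk <;> simp [hk]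
    rw [map_mul, map_mul, map_sub, map_sub, map_mul, map_one, PowerSeries.rescale_X, hC,
      PowerSeries.rescale_rescale, ← pow_succ'] at h
    rw [Finset.prod_range_succ, Finset.prod_range_succ, mul_right_comm, ih, map_mul]
    linear_combination (∏ i ∈ Finset.range N, (1 - PowerSeries.C (t * q ^ i) * PowerSeries.X)) * h

/-- The generating series `G = ∏_i (t x_i; q)_∞ / (x_i; q)_∞`: its coefficient at `x^d` is the
product over `i` of the coefficients of `u ^ (d i)` in `(t u; q)_∞ / (u; q)_∞`. -/
def gSeries {K : Type*} [Field K] (q t : K) : MvPowerSeries ℕ K :=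
  ofCoeff fun d => d.prod fun _ k => (qBinomialSeries q t).coeff k

/-- The symmetric function `g_k(x;q,t)`: the homogeneous component of degree `k` of
`∏_i (t x_i; q)_∞ / (x_i; q)_∞`. -/
def g {K : Type*} [Field K] (q t : K) (k : ℕ) : SymFun K k :=
  ⟨MvPowerSeries.homogeneousComponent k (gSeries q t), by
    apply mem_SymFun_of_coeff
    · intro d hd
      rw [MvPowerSeries.coeff_homogeneousComponent, if_neg hd]
    · intro d e h
      obtain ⟨σ, rfl⟩ := exists_perm_of_expType_eq h
      rw [MvPowerSeries.coeff_homogeneousComponent, MvPowerSeries.coeff_homogeneousComponent,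
        gSeries, coeff_ofCoeff, coeff_ofCoeff, Finsupp.prod_embDomain, ← expType_sum, h, expType_sum]⟩

/-- The product `g_λ = g_{λ_1} g_{λ_2} ⋯`. -/
def gProd {K : Type*} [Field K] (q t : K) {n : ℕ} (p : n.Partition) : SymFun K n :=
  symProd (g q t) p

/-- `b_λ(q,t) = ⟨P_λ, P_λ⟩⁻¹`. -/
def macdonaldB {K : Type*} [Field K] [CharZero K] (q t : K) {n : ℕ} (p : n.Partition) : K :=
  (scalarProduct q t n (macdonaldP q t n p) (macdonaldP q t n p))⁻¹

/-- The dual Macdonald symmetric function `Q_λ = b_λ P_λ`. -/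
def macdonaldQ {K : Type*} [Field K] [CharZero K] (q t : K) (n : ℕ) (p : n.Partition) :
    SymFun K n :=
  macdonaldB q t p • macdonaldP q t n p

open Classical in
/-- The coefficients `c_{λμ}` of the expansion `P_λ = ∑_μ c_{λμ} g_μ` of the Macdonald symmetric
functions in the basis `g_μ`. -/
def gToP {K : Type*} [Field K] [CharZero K] (q t : K) {n : ℕ} (p : n.Partition) :
    n.Partition → K :=
  if h : ∃ c : n.Partition → K, macdonaldP q t n p = ∑ r, c r • gProd q t r then h.choose else 0

/-- Rational functions over `K` in the variables `z_i`, `i : σ`. -/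
abbrev RatFn (K : Type*) [Field K] (σ : Type*) : Type _ := FractionRing (MvPolynomial σ K)

/-- The variable `z_i` as a rational function. -/
def zvar (K : Type*) [Field K] {σ : Type*} (i : σ) : RatFn K σ :=
  algebraMap (MvPolynomial σ K) (RatFn K σ) (MvPolynomial.X i)

theorem rename_toRat_injective (K : Type*) [Field K] {σ τ : Type*} (f : σ ↪ τ) :
    Function.Injective ((IsScalarTower.toAlgHom K (MvPolynomial τ K) (RatFn K τ)).comp
      (MvPolynomial.rename f)) :=
  (IsFractionRing.injective (MvPolynomial τ K) (RatFn K τ)).comp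
    (MvPolynomial.rename_injective f f.injective)

/-- The substitution `z_i ↦ z_{f i}` in rational functions, for an injective map `f`. -/
def renameRat {K : Type*} [Field K] {σ τ : Type*} (f : σ ↪ τ) : RatFn K σ →ₐ[K] RatFn K τ :=
  IsFractionRing.liftAlgHom (rename_toRat_injective K f)

theorem renameRat_zvar {K : Type*} [Field K] {σ τ : Type*} (f : σ ↪ τ) (i : σ) :
    renameRat f (zvar K i) = zvar K (f i) := by
  rw [renameRat, IsFractionRing.liftAlgHom_apply, zvar, IsFractionRing.lift_algebraMap]
  simp [zvar]

/-- `ω(z,w;q₁,q₂,q₃)`. -/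
def omega {L : Type*} [Field L] (q₁ q₂ q₃ z w : L) : L :=
  (z - q₁ * w) * (z - q₂ * w) * (z - q₃ * w) / (z - w) ^ 3

/-- The symmetrization `(1 / n!) ∑_σ f(z_{σ(1)}, …, z_{σ(n)})`. -/
def symmetrize {K : Type*} [Field K] {n : ℕ} (f : RatFn K (Fin n)) : RatFn K (Fin n) :=
  (n.factorial : RatFn K (Fin n))⁻¹ * ∑ σ : Equiv.Perm (Fin n), renameRat σ.toEmbedding f

/-- The star product `f * g` with parameters `q₁ = q⁻¹`, `q₂ = t`, `q₃ = q t⁻¹`: the symmetrization of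
`f(z_1, …, z_m) g(z_{m+1}, …, z_{m+n}) ∏_{α ≤ m < β} ω(z_α, z_β)`. -/
def starProd {K : Type*} [Field K] (q t : K) {m n : ℕ} (f : RatFn K (Fin m)) (g : RatFn K (Fin n)) :
    RatFn K (Fin (m + n)) :=
  symmetrize (renameRat (Fin.castAddEmb n) f * renameRat (Fin.natAddEmb m) g *
    ∏ α : Fin m, ∏ β : Fin n,
      omega (algebraMap K (RatFn K (Fin (m + n))) q⁻¹) (algebraMap K (RatFn K (Fin (m + n))) t)
        (algebraMap K (RatFn K (Fin (m + n))) (q * t⁻¹))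
        (zvar K (Fin.castAdd n α)) (zvar K (Fin.natAdd m β)))

/-- `ε_n(z_1, …, z_n; p) = ∏_{i < j} (z_i - p z_j) (z_i - p⁻¹ z_j) / (z_i - z_j)²`. -/
def eps {K : Type*} [Field K] (p : K) (n : ℕ) : RatFn K (Fin n) :=
  ∏ i : Fin n, ∏ j ∈ Finset.Ioi i,
    (zvar K i - algebraMap K (RatFn K (Fin n)) p * zvar K j) *
      (zvar K i - algebraMap K (RatFn K (Fin n)) p⁻¹ * zvar K j) / (zvar K i - zvar K j) ^ 2

/-- The star product `ε_{l_1}(z;p) * ε_{l_2}(z;p) * ⋯` over a list `l`. -/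
def epsList {K : Type*} [Field K] (q t p : K) : (l : List ℕ) → RatFn K (Fin l.sum)
  | [] => 1
  | a :: l => starProd q t (eps p a) (epsList q t p l)

/-- `ε_λ(z;p) = ε_{λ_1}(z;p) * ε_{λ_2}(z;p) * ⋯` for a partition `λ` of `n`. -/
def epsProd {K : Type*} [Field K] (q t p : K) {n : ℕ} (r : n.Partition) : RatFn K (Fin n) :=
  renameRat (finCongr (partList_sum r)).toEmbedding (epsList q t p (partList r))

/-- The rational function
`F_λ(z;q,t) = (-1)^n / ((1-q)^n n!) ∑_μ c_{λμ} ε_μ(z;t) n! / ∏_i μ_i!`,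
where the `c_{λμ}` are defined by `P_λ = ∑_μ c_{λμ} g_μ`. -/
def F {K : Type*} [Field K] [CharZero K] (q t : K) {n : ℕ} (p : n.Partition) : RatFn K (Fin n) :=
  algebraMap K (RatFn K (Fin n)) ((-1) ^ n / ((1 - q) ^ n * n.factorial)) *
    ∑ r : n.Partition, algebraMap K (RatFn K (Fin n))
      (gToP q t p r * (n.factorial / (r.parts.map fun k => (k.factorial : K)).prod)) *
        epsProd q t t r

open TensorProduct in
/-- The kernel function `K_n(x,z;q,t) = ∑_{λ ⊢ n} Q_λ(x) F_λ(z;q,t)`, as an element of the tensor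
product of the symmetric functions of degree `n` in `x` with the rational functions in
`z_1, …, z_n`. -/
def kernel {K : Type*} [Field K] [CharZero K] (q t : K) (n : ℕ) : SymFun K n ⊗[K] RatFn K (Fin n) :=
  ∑ p : n.Partition, macdonaldQ q t n p ⊗ₜ[K] F q t p

/-- The restriction `f(x_1, …, x_m) = f(x_1, …, x_m, 0, 0, …)` of a symmetric function of degree `n`
to `m` variables. -/
def restrict (K : Type*) [Field K] (m n : ℕ) : SymFun K n →ₗ[K] MvPolynomial (Fin m) K where
  toFun f := ∑ d ∈ Finset.finsuppAntidiag Finset.univ n,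
    MvPolynomial.monomial d
      ((MvPowerSeries.killCompl Fin.valEmbedding (f : MvPowerSeries ℕ K)).coeff d)
  map_add' f g := by simp [Finset.sum_add_distrib]
  map_smul' c f := by simp [Finset.smul_sum, MvPolynomial.smul_monomial]

theorem coe_restrict {K : Type*} [Field K] (m n : ℕ) (f : SymFun K n) :
    (restrict K m n f : MvPowerSeries (Fin m) K) =
      MvPowerSeries.killCompl Fin.valEmbedding (f : MvPowerSeries ℕ K) := by
  classical
  ext d
  rw [MvPolynomial.coeff_coe]
  simp only [restrict, LinearMap.coe_mk, AddHom.coe_mk, MvPolynomial.coeff_sum,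
    MvPolynomial.coeff_monomial, Finset.sum_ite_eq']
  split_ifs with h
  · rfl
  · rw [MvPowerSeries.coeff_killCompl]
    symm
    apply MvPowerSeries.IsHomogeneous.coeff_eq_zero f.2.1
    intro h'
    apply h
    rw [Finset.mem_finsuppAntidiag]
    refine ⟨?_, Finset.subset_univ _⟩
    rw [← h', Finsupp.embDomain_eq_mapDomain, Finsupp.degree_mapDomain, Finsupp.degree_eq_sum]

open TensorProduct in
/-- The restriction of the `x`-variables to `x_1, …, x_m` in the tensor product: the linear map
`f ⊗ h ↦ f(x_1, …, x_m) h` to polynomials in `x_1, …, x_m` with coefficients in the rational functions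
in the `z`-variables. -/
def restrictX (K : Type*) [Field K] (m n : ℕ) :
    SymFun K n ⊗[K] RatFn K (Fin n) →ₗ[K] MvPolynomial (Fin m) (RatFn K (Fin n)) :=
  TensorProduct.lift (LinearMap.mk₂ K
    (fun f h => h • MvPolynomial.map (algebraMap K (RatFn K (Fin n))) (restrict K m n f))
    (fun f g h => by simp)
    (fun c f h => by
      rw [map_smul, MvPolynomial.smul_eq_C_mul (restrict K m n f) c, map_mul, MvPolynomial.map_C,
        ← MvPolynomial.smul_eq_C_mul, algebraMap_smul, smul_comm])
    (fun f g h => by simp [add_smul])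
    (fun c f h => by simp))

/-- The rational function `γ_{i,j}(z,w;q,t)`. -/
def gamma {L : Type*} [Field L] (q t : L) {m : ℕ} (i j : Fin m) (z w : L) : L :=
  if i = j then (z - t * w) * (z - t⁻¹ * w) / (z - w) ^ 2
  else if i < j then (z - q⁻¹ * w) * (z - t * w) * (z - q * t⁻¹ * w) / (z - w) ^ 3
  else (z - q * w) * (z - t⁻¹ * w) * (z - q⁻¹ * t * w) / (z - w) ^ 3

/-- The field `ℚ(q,t)` of rational functions in two indeterminates. -/
abbrev Qqt : Type := FractionRing (MvPolynomial (Fin 2) ℚ)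

/-- The indeterminate `q` of `ℚ(q,t)`. -/
def qq : Qqt := algebraMap (MvPolynomial (Fin 2) ℚ) Qqt (MvPolynomial.X 0)

/-- The indeterminate `t` of `ℚ(q,t)`. -/
def tt : Qqt := algebraMap (MvPolynomial (Fin 2) ℚ) Qqt (MvPolynomial.X 1)

end MacdonaldKernel

end

open MacdonaldKernel

/-! The two sides are compared coefficient by coefficient in `x`; each coefficient turns out to be a
sum over ordered set partitions of the `z`-variables.

Left side. The `P_λ` enter only as an orthogonal basis with nonzero norms. The `g_μ` are dual to the
`m_μ` (`scalarProduct_gProd_mono`), so `c_{λμ} = ⟨P_λ, m_μ⟩`, and the sum of `⟨P_λ, m_μ⟩ Q_λ` over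
`λ` is `m_μ`. Hence, up to the prefactor, `K_n` is the sum over `μ` of `m_μ(x) · (n! / ∏ μ_i!)
ε_μ(z)` (`kernel_eq_sum_mono`). Unfolding the symmetrizations, `(n! / ∏ μ_i!) ε_μ` is `listSum`: the
sum over ordered set partitions with block sizes `μ_1, μ_2, …` of `ε` inside each block times `ω`
from each block to the later ones (`renameRat_epsList`).

Right side. A map `i` is the ordered set partition into its fibres. Since `γ_{ij}(z,w) =
γ_{ji}(w,z)`, the product of the `γ` may be ordered by colours instead of positions, and it becomes
`ε` inside the fibres and `ω` between them. So the coefficient of `x^d` is the same kind of sum with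
block sizes `d_1, …, d_m` (`sum_colorings`).

As `m_μ` has coefficient `1` exactly at the `d` whose nonzero entries rearrange `μ`, it remains to
see that `listSum` ignores empty blocks and the order of the blocks. The latter is the commutativity
of the `ε_r` under the star product, and it is the heart of the proof. Swapping two adjacent blocks
with union `U` and dividing by the symmetric factor `ε(U)` reduces it to `ratioSum_swap`: for `f =
ω/ε`, the sum of `∏_{i ∈ S, j ∉ S} f(z_i, z_j)` over the `a`-subsets `S` of `U` equals that over the
subsets with `a`-element complement. This is proved by interpolation in one variable, using `f(p x,
y) = f(y, x)` for `p = t⁻¹`.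

Two supporting arguments. Duality follows from Newton's identity for the `g_n`, which makes `p_k`
act on the `g_μ` by an adjoint differential operator. Norms are nonzero because `ℚ(q,t)` embeds in
`ℝ` with `q` and `t` in `(0,1)`, where the scalar product is positive definite. -/

noncomputable section

namespace MacdonaldKernel

/-! ### Commutativity of the `ε_r`: a subset-sum identity proved by interpolation -/

section Commutativity

variable {L ι : Type*} [Field L] [DecidableEq ι]

/-- The ratio `ω(x, y) / ε(x, y)`, where `p = t⁻¹`. -/
def ratioFactor (q p x y : L) : L :=
  (x - q⁻¹ * y) * (x - q * p * y) / ((x - y) * (x - p * y))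

/-- The common denominator of `ratioFactor q p x y` and `ratioFactor q p y x`. -/
def ratioDen (p x y : L) : L := (x - y) * (x - p * y) * (y - p * x)

/-- The numerator of `ratioFactor q p x y` over `ratioDen p x y`. -/
def ratioNumL (q p x y : L) : L := (x - q⁻¹ * y) * (x - q * p * y) * (y - p * x)

/-- The numerator of `ratioFactor q p y x` over `ratioDen p x y`. -/
def ratioNumR (q p x y : L) : L := -((y - q⁻¹ * x) * (y - q * p * x) * (x - p * y))

/-- Pairwise genericity of a family of points with respect to multiplication by `p`. -/
structure Generic (p : L) (z : ι → L) : Prop where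
  ne_zero : ∀ i, z i ≠ 0
  ne : ∀ i j, i ≠ j → z i ≠ z j
  ne_mul : ∀ i j, i ≠ j → z i ≠ p * z j
  ne_sq_mul : ∀ i j, i ≠ j → z i ≠ p ^ 2 * z j

theorem ratioFactor_mul_den {q p x y : L} (h1 : x ≠ y) (h2 : x ≠ p * y) :
    ratioFactor q p x y * ratioDen p x y = ratioNumL q p x y := by
  have this0 := sub_ne_zero.2 h1
  have this1 := sub_ne_zero.2 h2
  rw [ratioFactor, ratioDen, ratioNumL]
  rw [div_mul_eq_mul_div, div_eq_iff (mul_ne_zero this0 this1)]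
  ring

theorem ratioFactor_swap_mul_den {q p x y : L} (h1 : y ≠ x) (h2 : y ≠ p * x) :
    ratioFactor q p y x * ratioDen p x y = ratioNumR q p x y := by
  have h3 := sub_ne_zero.2 h1
  have h4 := sub_ne_zero.2 h2
  rw [ratioFactor, ratioDen, ratioNumR, div_mul_eq_mul_div, div_eq_iff (mul_ne_zero h3 h4)]
  ring

/-- Denominator-free form of the shift relation `f(p x, y) = f(y, x)` for `f = ratioFactor`; it lets
the interpolation at `p z_k` close up. -/
theorem ratioNumL_mul_left {q p x y : L} (hq : q ≠ 0) (hp : p ≠ 0) (h1 : y ≠ x) (h2 : y ≠ p * x) :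
    ratioFactor q p y x * ratioDen p (p * x) y = ratioNumL q p (p * x) y := by
  have h3 := sub_ne_zero.2 h1
  have h4 := sub_ne_zero.2 h2
  rw [ratioFactor, ratioDen, ratioNumL, div_mul_eq_mul_div, div_eq_iff (mul_ne_zero h3 h4)]
  field_simp
  ring

/-- The same shift relation read backwards, `f(y, p⁻¹ x) = f(x, y)`, for the interpolation at `p⁻¹
z_k`. -/
theorem ratioNumR_mul_left {q p x y : L} (hq : q ≠ 0) (hp : p ≠ 0) (h1 : x ≠ y) (h2 : x ≠ p * y) :
    ratioFactor q p x y * ratioDen p (p⁻¹ * x) y = ratioNumR q p (p⁻¹ * x) y := by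
  have h3 := sub_ne_zero.2 h1
  have h4 := sub_ne_zero.2 h2
  rw [ratioFactor, ratioDen, ratioNumR, div_mul_eq_mul_div, div_eq_iff (mul_ne_zero h3 h4)]
  field_simp
  ring

/-- The product of `ratioFactor` over `S × (A \ S)`. -/
def ratioProd (q p : L) (z : ι → L) (A S : Finset ι) : L :=
  ∏ i ∈ S, ∏ j ∈ A \ S, ratioFactor q p (z i) (z j)

/-- The sum over all subsets `S` of `A` of `ratioProd`, with weights depending on the cardinalities of
`S` and of its complement. -/
def ratioSum (q p : L) (z : ι → L) (A : Finset ι) (c : ℕ → ℕ → L) : L :=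
  ∑ S ∈ A.powerset, c S.card (A \ S).card * ratioProd q p z A S

theorem ratioProd_insert_left {q p : L} {z : ι → L} {B S : Finset ι} {k : ι} (hk : k ∉ B)
    (hS : S ⊆ B) : ratioProd q p z (insert k B) S =
      ratioProd q p z B S * ∏ i ∈ S, ratioFactor q p (z i) (z k) := by
  have hkS : k ∉ S := fun h => hk (hS h)
  rw [ratioProd, ratioProd, ← Finset.prod_mul_distrib]
  refine Finset.prod_congr rfl fun i _ => ?_
  rw [Finset.insert_sdiff_of_notMem _ hkS, Finset.prod_insert (by simp [hk]), mul_comm]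

theorem insert_sdiff_insert' {B S : Finset ι} {k : ι} (hk : k ∉ B) :
    insert k B \ insert k S = B \ S := by
  ext i
  simp only [Finset.mem_sdiff, Finset.mem_insert, not_or]
  constructor
  · rintro ⟨h1 | h1, h2, h3⟩
    · exact absurd h1 h2
    · exact ⟨h1, h3⟩
  · rintro ⟨h1, h2⟩
    exact ⟨Or.inr h1, fun h => hk (h ▸ h1), h2⟩

theorem ratioProd_insert_insert {q p : L} {z : ι → L} {B S : Finset ι} {k : ι} (hk : k ∉ B)
    (hS : S ⊆ B) : ratioProd q p z (insert k B) (insert k S) =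
      ratioProd q p z B S * ∏ j ∈ B \ S, ratioFactor q p (z k) (z j) := by
  have hkS : k ∉ S := fun h => hk (hS h)
  rw [ratioProd, ratioProd, insert_sdiff_insert' hk, Finset.prod_insert hkS, mul_comm]

/-- `ratioSum` of `A` and one more point `x`, cleared of its denominators, as a function of `x`. -/
def clearedSum (q p : L) (z : ι → L) (A : Finset ι) (c : ℕ → ℕ → L) (x : L) : L :=
  ∑ S ∈ A.powerset, ratioProd q p z A S *
    (c (S.card + 1) (A \ S).card *
        ((∏ j ∈ A \ S, ratioNumL q p x (z j)) * ∏ j ∈ S, ratioDen p x (z j)) +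
      c S.card ((A \ S).card + 1) *
        ((∏ j ∈ A \ S, ratioDen p x (z j)) * ∏ j ∈ S, ratioNumR q p x (z j)))

/-- Split the subsets of `insert k A` by whether they contain `k`. Each `j ∈ A` then meets `k` in
exactly one factor, `f(z_k, z_j)` or `f(z_j, z_k)`, and `ratioDen` is a common denominator of the
two. -/
theorem ratioSum_insert {q p : L} {z : ι → L} (hz : Generic p z) {A : Finset ι} {k : ι} (hk : k ∉ A)
    (c : ℕ → ℕ → L) : ratioSum q p z (insert k A) c * ∏ j ∈ A, ratioDen p (z k) (z j) =
      clearedSum q p z A c (z k) := by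
  rw [ratioSum, Finset.sum_powerset_insert hk, ← Finset.sum_add_distrib, clearedSum, Finset.sum_mul]
  refine Finset.sum_congr rfl fun S hS => ?_
  rw [Finset.mem_powerset] at hS
  have hkS : k ∉ S := fun h => hk (hS h)
  have hne : ∀ j ∈ A, k ≠ j := fun j hj h => hk (h ▸ hj)
  rw [ratioProd_insert_left hk hS, ratioProd_insert_insert hk hS, insert_sdiff_insert' hk,
    Finset.insert_sdiff_of_notMem _ hkS, Finset.card_insert_of_notMem hkS,
    Finset.card_insert_of_notMem (by simp [hk]), ← Finset.prod_sdiff hS]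
  have h1 : ∏ j ∈ A \ S, ratioNumL q p (z k) (z j) =
      (∏ j ∈ A \ S, ratioFactor q p (z k) (z j)) * ∏ j ∈ A \ S, ratioDen p (z k) (z j) := by
    rw [← Finset.prod_mul_distrib]
    refine Finset.prod_congr rfl fun j hj => (ratioFactor_mul_den ?_ ?_).symm
    · exact hz.ne _ _ (hne j (Finset.sdiff_subset hj))
    · exact hz.ne_mul _ _ (hne j (Finset.sdiff_subset hj))
  have h2 : ∏ j ∈ S, ratioNumR q p (z k) (z j) =
      (∏ j ∈ S, ratioFactor q p (z j) (z k)) * ∏ j ∈ S, ratioDen p (z k) (z j) := by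
    rw [← Finset.prod_mul_distrib]
    refine Finset.prod_congr rfl fun j hj => (ratioFactor_swap_mul_den ?_ ?_).symm
    · exact hz.ne _ _ (hne j (hS hj)).symm
    · exact hz.ne_mul _ _ (hne j (hS hj)).symm
  rw [h1, h2]
  ring

/-- Where the denominator for the pair `x, z_k` vanishes, only the terms with `x` and `z_k` on
opposite sides of the subset survive. There are two of them for each `S ⊆ B`, and both carry the
weight `c (|S| + 1) (|B \ S| + 1)`. -/
theorem clearedSum_insert {q p : L} {z : ι → L} {B : Finset ι} {k : ι} (hk : k ∉ B)
    (c : ℕ → ℕ → L) {x : L} (hd : ratioDen p x (z k) = 0) :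
    clearedSum q p z (insert k B) c x = ∑ S ∈ B.powerset, ratioProd q p z B S *
      c (S.card + 1) ((B \ S).card + 1) *
      (ratioNumL q p x (z k) * ((∏ j ∈ B \ S, ratioNumL q p x (z j)) *
          ∏ j ∈ S, ratioFactor q p (z j) (z k) * ratioDen p x (z j)) +
        ratioNumR q p x (z k) * ((∏ j ∈ B \ S, ratioFactor q p (z k) (z j) * ratioDen p x (z j)) *
          ∏ j ∈ S, ratioNumR q p x (z j))) := by
  rw [clearedSum, Finset.sum_powerset_insert hk, ← Finset.sum_add_distrib]
  refine Finset.sum_congr rfl fun S hS => ?_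
  rw [Finset.mem_powerset] at hS
  have hkS : k ∉ S := fun h => hk (hS h)
  have hkB : k ∉ B \ S := by simp [hk]
  rw [ratioProd_insert_left hk hS, ratioProd_insert_insert hk hS, insert_sdiff_insert' hk,
    Finset.insert_sdiff_of_notMem _ hkS, Finset.card_insert_of_notMem hkS,
    Finset.card_insert_of_notMem hkB, Finset.prod_insert hkB, Finset.prod_insert hkB,
    Finset.prod_insert hkS, Finset.prod_insert hkS, hd, Finset.prod_mul_distrib,
    Finset.prod_mul_distrib]
  ring

/-- The pole of `ratioSum` at `x = z_k` is only apparent: exchanging the coinciding points `x` and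
`z_k` matches the two surviving terms up to sign, and they cancel. -/
theorem clearedSum_self {q p : L} {z : ι → L} (hz : Generic p z) {A : Finset ι} {k : ι} (hk : k ∈ A)
    (c : ℕ → ℕ → L) : clearedSum q p z A c (z k) = 0 := by
  obtain ⟨B, hkB, rfl⟩ : ∃ B, k ∉ B ∧ A = insert k B :=
    ⟨A.erase k, by simp, (Finset.insert_erase hk).symm⟩
  have hne : ∀ j ∈ B, k ≠ j := fun j hj h => hkB (h ▸ hj)
  rw [clearedSum_insert hkB c (by simp [ratioDen])]
  refine Finset.sum_eq_zero fun S hS => ?_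
  rw [Finset.mem_powerset] at hS
  rw [Finset.prod_congr rfl fun j hj => ratioFactor_swap_mul_den (hz.ne _ _ (hne j (hS hj)).symm)
      (hz.ne_mul _ _ (hne j (hS hj)).symm),
    Finset.prod_congr rfl fun j hj => ratioFactor_mul_den
      (hz.ne _ _ (hne j (Finset.sdiff_subset hj))) (hz.ne_mul _ _ (hne j (Finset.sdiff_subset hj)))]
  have : ratioNumR q p (z k) (z k) = - ratioNumL q p (z k) (z k) := by
    rw [ratioNumR, ratioNumL]
  rw [this]
  ring

/-- At `x = p z_k` one of the two surviving terms is zero. In the other, the shift relation merges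
the factors of `z_k` with those of `x` into a product independent of `S`, which leaves a sum of the
same shape over the smaller set `B`. -/
theorem clearedSum_mul {q p : L} (hq : q ≠ 0) (hp : p ≠ 0) {z : ι → L} (hz : Generic p z)
    {B : Finset ι} {k : ι} (hk : k ∉ B) (c : ℕ → ℕ → L) :
    clearedSum q p z (insert k B) c (p * z k) =
      ratioNumL q p (p * z k) (z k) * (∏ j ∈ B, ratioNumL q p (p * z k) (z j)) *
        ratioSum q p z B fun a b => c (a + 1) (b + 1) := by
  have hne : ∀ j ∈ B, k ≠ j := fun j hj h => hk (h ▸ hj)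
  rw [clearedSum_insert hk c (by simp [ratioDen]), ratioSum, Finset.mul_sum]
  refine Finset.sum_congr rfl fun S hS => ?_
  rw [Finset.mem_powerset] at hS
  rw [Finset.prod_congr rfl fun j hj => ratioNumL_mul_left hq hp (hz.ne _ _ (hne j (hS hj)).symm)
      (hz.ne_mul _ _ (hne j (hS hj)).symm), ← Finset.prod_sdiff hS]
  have : ratioNumR q p (p * z k) (z k) = 0 := by simp [ratioNumR]
  rw [this]
  ring

theorem clearedSum_inv_mul {q p : L} (hq : q ≠ 0) (hp : p ≠ 0) {z : ι → L} (hz : Generic p z)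
    {B : Finset ι} {k : ι} (hk : k ∉ B) (c : ℕ → ℕ → L) :
    clearedSum q p z (insert k B) c (p⁻¹ * z k) =
      ratioNumR q p (p⁻¹ * z k) (z k) * (∏ j ∈ B, ratioNumR q p (p⁻¹ * z k) (z j)) *
        ratioSum q p z B fun a b => c (a + 1) (b + 1) := by
  have hne : ∀ j ∈ B, k ≠ j := fun j hj h => hk (h ▸ hj)
  rw [clearedSum_insert hk c (by simp [ratioDen, mul_inv_cancel_left₀ hp]), ratioSum, Finset.mul_sum]
  refine Finset.sum_congr rfl fun S hS => ?_
  rw [Finset.mem_powerset] at hS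
  rw [Finset.prod_congr (s₁ := B \ S) rfl fun j hj => ratioNumR_mul_left hq hp
      (hz.ne _ _ (hne j (Finset.sdiff_subset hj))) (hz.ne_mul _ _ (hne j (Finset.sdiff_subset hj))),
    ← Finset.prod_sdiff hS]
  have : ratioNumL q p (p⁻¹ * z k) (z k) = 0 := by simp [ratioNumL, mul_inv_cancel_left₀ hp]
  rw [this]
  ring

/-- At `x = 0` both numerators equal the denominator, so every ratio involving `x` is `1` and only
the weights remember on which side `x` lies. -/
theorem clearedSum_zero {q p : L} (hq : q ≠ 0) {z : ι → L} (A : Finset ι)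
    (c : ℕ → ℕ → L) : clearedSum q p z A c 0 =
      (∏ j ∈ A, p * z j ^ 3) * ratioSum q p z A fun a b => c (a + 1) b + c a (b + 1) := by
  have h1 : ∀ y, ratioNumL q p 0 y = p * y ^ 3 := fun y => by rw [ratioNumL]; field_simp; ring
  have h2 : ∀ y, ratioNumR q p 0 y = p * y ^ 3 := fun y => by rw [ratioNumR]; ring
  have h3 : ∀ y, ratioDen p 0 y = p * y ^ 3 := fun y => by rw [ratioDen]; ring
  rw [clearedSum, ratioSum, Finset.mul_sum]
  refine Finset.sum_congr rfl fun S hS => ?_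
  rw [Finset.mem_powerset] at hS
  simp only [h1, h2, h3]
  rw [Finset.prod_sdiff hS]
  ring

open Polynomial in
-- Each `j ∈ A` contributes one factor of degree at most `3` in `x`, so the values at `3|A| + 1`
-- points determine the function.
theorem exists_polynomial_clearedSum (q p : L) (z : ι → L) (A : Finset ι) (c : ℕ → ℕ → L) :
    ∃ P : L[X], P.natDegree ≤ 3 * A.card ∧ ∀ x, P.eval x = clearedSum q p z A c x := by
  have lin : ∀ a b : L, (C a * X + C b).natDegree ≤ 1 := fun a b => natDegree_linear_le
  have cub : ∀ a b a' b' a'' b'' : L,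
      ((C a * X + C b) * (C a' * X + C b') * (C a'' * X + C b'')).natDegree ≤ 3 := fun _ _ _ _ _ _ =>
    natDegree_mul_le_of_le (natDegree_mul_le_of_le (lin _ _) (lin _ _)) (lin _ _)
  have hden : ∀ y, ∃ P : L[X], P.natDegree ≤ 3 ∧ ∀ x, P.eval x = ratioDen p x y := fun y =>
    ⟨_, cub 1 (-y) 1 (-(p * y)) (-p) y, fun x => by simp [ratioDen]; ring⟩
  have hL : ∀ y, ∃ P : L[X], P.natDegree ≤ 3 ∧ ∀ x, P.eval x = ratioNumL q p x y := fun y =>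
    ⟨_, cub 1 (-(q⁻¹ * y)) 1 (-(q * p * y)) (-p) y, fun x => by simp [ratioNumL]; ring⟩
  have hR : ∀ y, ∃ P : L[X], P.natDegree ≤ 3 ∧ ∀ x, P.eval x = ratioNumR q p x y := fun y =>
    ⟨_, cub q⁻¹ (-y) (-(q * p)) y 1 (-(p * y)), fun x => by simp [ratioNumR]; ring⟩
  choose D hD hD' using hden
  choose U hU hU' using hL
  choose V hV hV' using hR
  refine ⟨∑ S ∈ A.powerset, C (ratioProd q p z A S) *
    (C (c (S.card + 1) (A \ S).card) * ((∏ j ∈ A \ S, U (z j)) * ∏ j ∈ S, D (z j)) +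
      C (c S.card ((A \ S).card + 1)) * ((∏ j ∈ A \ S, D (z j)) * ∏ j ∈ S, V (z j))), ?_, ?_⟩
  · refine natDegree_sum_le_of_forall_le _ _ fun S hS => ?_
    rw [Finset.mem_powerset] at hS
    have key : ∀ W W' : L → L[X], (∀ y, (W y).natDegree ≤ 3) → (∀ y, (W' y).natDegree ≤ 3) →
        ((∏ j ∈ A \ S, W (z j)) * ∏ j ∈ S, W' (z j)).natDegree ≤ 3 * A.card := by
      intro W W' hW hW'
      refine natDegree_mul_le.trans ?_
      have h1 := (natDegree_prod_le (A \ S) fun j => W (z j)).trans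
        (Finset.sum_le_card_nsmul _ _ 3 fun j _ => hW (z j))
      have h2 := (natDegree_prod_le S fun j => W' (z j)).trans
        (Finset.sum_le_card_nsmul _ _ 3 fun j _ => hW' (z j))
      have h3 := Finset.card_sdiff_add_card_eq_card hS
      simp only [smul_eq_mul] at h1 h2
      omega
    refine (natDegree_C_mul_le _ _).trans ((natDegree_add_le _ _).trans (max_le ?_ ?_))
    · exact (natDegree_C_mul_le _ _).trans (key _ _ hU hD)
    · exact (natDegree_C_mul_le _ _).trans (key _ _ hD hV)
  · intro x
    simp only [eval_finsetSum, eval_mul, eval_C, eval_add, eval_prod, hD', hU', hV', clearedSum]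

/-- Induction on `A`, with the cleared sum viewed as a polynomial in one of the points. Its values
at `0`, `z_j`, `p z_j` and `p⁻¹ z_j` are zero or multiples of sums over smaller sets. The weights
must be arbitrary because these smaller sums have shifted weights. -/
theorem ratioSum_swap {q p : L} (hq : q ≠ 0) (hp : p ≠ 0) (hp2 : p ^ 2 ≠ 1) {z : ι → L}
    (hz : Generic p z) (A : Finset ι) : ∀ c : ℕ → ℕ → L,
      ratioSum q p z A c = ratioSum q p z A fun a b => c b a := by
  classical
  have hp1 : p ≠ 1 := by rintro rfl; simp at hp2
  induction A using Finset.strongInduction with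
  | _ A ih =>
  intro c
  rcases A.eq_empty_or_nonempty with rfl | ⟨k, hk⟩
  · simp [ratioSum]
  obtain ⟨B, hkB, rfl⟩ : ∃ B, k ∉ B ∧ A = insert k B :=
    ⟨A.erase k, by simp, (Finset.insert_erase hk).symm⟩
  have hne : ∀ j ∈ B, k ≠ j := fun j hj h => hkB (h ▸ hj)
  have hsub : B ⊂ insert k B := Finset.ssubset_insert hkB
  obtain ⟨P, hP, hP'⟩ := exists_polynomial_clearedSum q p z B c
  obtain ⟨P₂, hP₂, hP₂'⟩ := exists_polynomial_clearedSum q p z B fun a b => c b a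
  have hz_inj : ∀ i j, z i = z j → i = j := fun i j h => by_contra fun hij => hz.ne i j hij h
  have h12 : Disjoint (B.image z) (B.image fun j => p * z j) := by
    rw [Finset.disjoint_left]
    rintro x hx hx'
    obtain ⟨i, _, rfl⟩ := Finset.mem_image.1 hx
    obtain ⟨j, _, h⟩ := Finset.mem_image.1 hx'
    rcases eq_or_ne i j with rfl | hij
    · exact hp1 (mul_right_cancel₀ (hz.ne_zero i) (by rw [h, one_mul]))
    · exact hz.ne_mul i j hij h.symm
  -- Here `ne_sq_mul` and `p ^ 2 ≠ 1` are needed: `p z_i = p⁻¹ z_j` means `z_j = p² z_i`.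
  have h13 : Disjoint (B.image z ∪ B.image fun j => p * z j) (B.image fun j => p⁻¹ * z j) := by
    rw [Finset.disjoint_left]
    rintro x hx hx'
    obtain ⟨j, _, h⟩ := Finset.mem_image.1 hx'
    rcases Finset.mem_union.1 hx with hx | hx
    · obtain ⟨i, _, rfl⟩ := Finset.mem_image.1 hx
      have h' : z j = p * z i := by rw [← h, mul_inv_cancel_left₀ hp]
      rcases eq_or_ne j i with rfl | hij
      · exact hp1 (mul_right_cancel₀ (hz.ne_zero j) (by rw [← h', one_mul]))
      · exact hz.ne_mul j i hij h'
    · obtain ⟨i, _, rfl⟩ := Finset.mem_image.1 hx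
      have h' : z j = p ^ 2 * z i := by rw [pow_two, mul_assoc, ← h, mul_inv_cancel_left₀ hp]
      rcases eq_or_ne j i with rfl | hij
      · exact hp2 (mul_right_cancel₀ (hz.ne_zero j) (by rw [← h', one_mul]))
      · exact hz.ne_sq_mul j i hij h'
  have h0 : (0 : L) ∉ B.image z ∪ (B.image fun j => p * z j) ∪ B.image fun j => p⁻¹ * z j := by
    simp [hz.ne_zero, hp]
  -- One point more than the degree bound `3|B|`.
  have hcard : (insert 0 (B.image z ∪ (B.image fun j => p * z j) ∪
      B.image fun j => p⁻¹ * z j)).card = 3 * B.card + 1 := by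
    rw [Finset.card_insert_of_notMem h0, Finset.card_union_of_disjoint h13,
      Finset.card_union_of_disjoint h12, Finset.card_image_of_injective,
      Finset.card_image_of_injective, Finset.card_image_of_injective]
    · ring
    · exact fun i j h => hz_inj i j (mul_left_cancel₀ (inv_ne_zero hp) h)
    · exact fun i j h => hz_inj i j (mul_left_cancel₀ hp h)
    · exact fun i j h => hz_inj i j h
  have hzero : P - P₂ = 0 := by
    refine Polynomial.eq_zero_of_natDegree_lt_card_of_eval_eq_zero' _ (insert 0 (B.image z ∪
      (B.image fun j => p * z j) ∪ B.image fun j => p⁻¹ * z j)) ?_ ?_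
    · intro x hx
      rw [Polynomial.eval_sub, hP', hP₂', sub_eq_zero]
      simp only [Finset.mem_insert, Finset.mem_union, Finset.mem_image] at hx
      have hB : ∀ j ∈ B, ∃ D, j ∉ D ∧ B = insert j D ∧ D ⊂ insert k B := fun j hj =>
        ⟨B.erase j, by simp, (Finset.insert_erase hj).symm, (Finset.erase_ssubset hj).trans hsub⟩
      rcases hx with rfl | (⟨j, hj, rfl⟩ | ⟨j, hj, rfl⟩) | ⟨j, hj, rfl⟩
      -- The weights `c (a+1) b + c a (b+1)` of one side are the transpose of those of the other, up
      -- to the order of the two summands.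
      · rw [clearedSum_zero hq, clearedSum_zero hq, ih B hsub]
        simp only [add_comm]
      · rw [clearedSum_self hz hj, clearedSum_self hz hj]
      · obtain ⟨D, hD, hBD, hDA⟩ := hB j hj
        rw [hBD, clearedSum_mul hq hp hz hD, clearedSum_mul hq hp hz hD, ih D hDA]
      · obtain ⟨D, hD, hBD, hDA⟩ := hB j hj
        rw [hBD, clearedSum_inv_mul hq hp hz hD, clearedSum_inv_mul hq hp hz hD, ih D hDA]
    · rw [hcard]
      exact Nat.lt_succ_of_le ((Polynomial.natDegree_sub_le _ _).trans (max_le hP hP₂))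
  have hfin : clearedSum q p z B c (z k) = clearedSum q p z B (fun a b => c b a) (z k) := by
    rw [← hP', ← hP₂', sub_eq_zero.1 hzero]
  rw [← ratioSum_insert hz hkB, ← ratioSum_insert hz hkB] at hfin
  refine mul_right_cancel₀ (Finset.prod_ne_zero_iff.2 fun j hj => ?_) hfin
  exact mul_ne_zero (mul_ne_zero (sub_ne_zero.2 (hz.ne _ _ (hne j hj)))
    (sub_ne_zero.2 (hz.ne_mul _ _ (hne j hj)))) (sub_ne_zero.2 (hz.ne_mul _ _ (hne j hj).symm))

end Commutativity

/-! ### Products over unordered pairs -/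

section PairProd

variable {L ι : Type*} [Field L] [LinearOrder ι]

/-- The product of `h i j` over the pairs `i < j` in `A`. -/
def pairProd (h : ι → ι → L) (A : Finset ι) : L :=
  ∏ i ∈ A, ∏ j ∈ A, if i < j then h i j else 1

theorem pairProd_union {h : ι → ι → L} (hsymm : ∀ i j, h i j = h j i) {S S' : Finset ι}
    (hd : Disjoint S S') : pairProd h (S ∪ S') =
      pairProd h S * pairProd h S' * ∏ i ∈ S, ∏ j ∈ S', h i j := by
  have hcross : (∏ i ∈ S, ∏ j ∈ S', h i j) = (∏ i ∈ S, ∏ j ∈ S', if i < j then h i j else 1) *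
      ∏ i ∈ S', ∏ j ∈ S, if i < j then h i j else 1 := by
    rw [Finset.prod_comm (s := S') (t := S), ← Finset.prod_mul_distrib]
    refine Finset.prod_congr rfl fun i hi => ?_
    rw [← Finset.prod_mul_distrib]
    refine Finset.prod_congr rfl fun j hj => ?_
    have hij : i ≠ j := fun h => Finset.disjoint_left.1 hd hi (h ▸ hj)
    rcases lt_or_gt_of_ne hij with h | h
    · rw [if_pos h, if_neg h.not_gt, mul_one]
    · rw [if_neg h.not_gt, if_pos h, one_mul, hsymm]
  rw [hcross, pairProd, pairProd, pairProd, Finset.prod_union hd]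
  simp only [Finset.prod_union hd, Finset.prod_mul_distrib]
  ring

theorem pairProd_congr {h h' : ι → ι → L} {A : Finset ι} (H : ∀ i ∈ A, ∀ j ∈ A, h i j = h' i j) :
    pairProd h A = pairProd h' A :=
  Finset.prod_congr rfl fun i hi => Finset.prod_congr rfl fun j hj => by rw [H i hi j hj]

/-- For symmetric `h` the condition `i < j` only selects one representative of each pair, so `e`
need not be monotone. -/
theorem pairProd_map {κ : Type*} [LinearOrder κ] {h : ι → ι → L} (hsymm : ∀ i j, h i j = h j i)
    (e : κ ↪ ι) (A : Finset κ) : pairProd h (A.map e) = pairProd (fun i j => h (e i) (e j)) A := by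
  induction A using Finset.induction_on with
  | empty => simp [pairProd]
  | insert k A hk ih =>
    rw [Finset.map_insert, Finset.insert_eq, Finset.insert_eq, pairProd_union hsymm (by simpa using hk),
      pairProd_union (fun i j => hsymm _ _) (by simpa using hk), ih, Finset.prod_singleton,
      Finset.prod_singleton, Finset.prod_map]
    simp [pairProd]

end PairProd

/-! ### Sums over ordered set partitions and their invariance under reordering blocks -/

section ListSum

variable {L ι : Type*} [Field L]

/-- The factor of `eps` for a pair of variables. -/
def epsFactor (t x y : L) : L := (x - t * y) * (x - t⁻¹ * y) / (x - y) ^ 2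

theorem epsFactor_symm {t : L} (ht : t ≠ 0) (x y : L) : epsFactor t x y = epsFactor t y x := by
  rw [epsFactor, epsFactor, ← neg_sub y x, neg_sq]
  congr 1
  field_simp
  ring

theorem epsFactor_mul_ratioFactor {q t x y : L} (h : x ≠ y)
    (h' : x ≠ t⁻¹ * y) :
    epsFactor t x y * ratioFactor q t⁻¹ x y = omega q⁻¹ t (q * t⁻¹) x y := by
  have h1 := sub_ne_zero.2 h
  have h2 := sub_ne_zero.2 h'
  rw [epsFactor, ratioFactor, omega, div_mul_div_comm,
    div_eq_div_iff (mul_ne_zero (pow_ne_zero _ h1) (mul_ne_zero h1 h2)) (pow_ne_zero _ h1)]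
  ring

variable [LinearOrder ι]

/-- The product of `ω(z_i, z_j)` over `S × S'`. -/
def crossProd (q t : L) (z : ι → L) (S S' : Finset ι) : L :=
  ∏ i ∈ S, ∏ j ∈ S', omega q⁻¹ t (q * t⁻¹) (z i) (z j)

/-- The product `ε(z_i : i ∈ S)`. -/
def epsSet (t : L) (z : ι → L) (S : Finset ι) : L :=
  pairProd (fun i j => epsFactor t (z i) (z j)) S

/-- The sum over all ordered set partitions of `A` with blocks of the given sizes of the products of
`ε` of each block and of `ω` of each pair of elements of different blocks. -/
def listSum (q t : L) (z : ι → L) : Finset ι → List ℕ → L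
  | A, [] => if A = ∅ then 1 else 0
  | A, a :: l => ∑ S ∈ A.powersetCard a,
      epsSet t z S * crossProd q t z S (A \ S) * listSum q t z (A \ S) l

theorem crossProd_sdiff_right {q t : L} {z : ι → L} {S U A : Finset ι} (h : U ⊆ A) :
    crossProd q t z S A = crossProd q t z S U * crossProd q t z S (A \ U) := by
  rw [crossProd, crossProd, crossProd, ← Finset.prod_mul_distrib]
  refine Finset.prod_congr rfl fun i _ => ?_
  rw [← Finset.prod_sdiff h, mul_comm]

theorem crossProd_sdiff_left {q t : L} {z : ι → L} {S U A : Finset ι} (h : S ⊆ U) :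
    crossProd q t z U A = crossProd q t z S A * crossProd q t z (U \ S) A := by
  rw [crossProd, crossProd, crossProd, ← Finset.prod_sdiff h, mul_comm]

/-- Regroup by the union `U` of the first two blocks: their cross factors with the remaining blocks
depend on `U` only, which isolates the sum over ways to split `U`. -/
theorem listSum_cons_cons (q t : L) (z : ι → L) (A : Finset ι) (a b : ℕ) (l : List ℕ) :
    listSum q t z A (a :: b :: l) = ∑ U ∈ A.powersetCard (a + b),
      crossProd q t z U (A \ U) * listSum q t z (A \ U) l *
        ∑ S ∈ U.powersetCard a, epsSet t z S * epsSet t z (U \ S) * crossProd q t z S (U \ S) := by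
  simp only [listSum, Finset.mul_sum]
  rw [Finset.sum_sigma', Finset.sum_sigma']
  refine Finset.sum_bij' (fun x _ => ⟨x.1 ∪ x.2, x.1⟩) (fun x _ => ⟨x.2, x.1 \ x.2⟩) ?_ ?_ ?_ ?_ ?_
  · rintro ⟨S, S'⟩ h
    simp only [Finset.mem_sigma, Finset.mem_powersetCard, Finset.subset_sdiff] at h ⊢
    obtain ⟨⟨h1, rfl⟩, ⟨h2, h3⟩, rfl⟩ := h
    exact ⟨⟨Finset.union_subset h1 h2, Finset.card_union_of_disjoint h3.symm⟩,
      Finset.subset_union_left, rfl⟩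
  · rintro ⟨U, S⟩ h
    simp only [Finset.mem_sigma, Finset.mem_powersetCard] at h ⊢
    obtain ⟨⟨h1, h2⟩, h3, rfl⟩ := h
    refine ⟨⟨h3.trans h1, rfl⟩, Finset.sdiff_subset_sdiff h1 subset_rfl, ?_⟩
    rw [Finset.card_sdiff_of_subset h3]
    omega
  · rintro ⟨S, S'⟩ h
    simp only [Finset.mem_sigma, Finset.mem_powersetCard, Finset.subset_sdiff] at h
    obtain ⟨⟨h1, rfl⟩, ⟨h2, h3⟩, rfl⟩ := h
    simp only [Sigma.mk.injEq, heq_eq_eq, true_and]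
    exact Finset.union_sdiff_cancel_left h3.symm
  · rintro ⟨U, S⟩ h
    simp only [Finset.mem_sigma, Finset.mem_powersetCard] at h
    obtain ⟨⟨h1, h2⟩, h3, rfl⟩ := h
    simp only [Sigma.mk.injEq, heq_eq_eq, and_true]
    exact Finset.union_sdiff_of_subset h3
  · rintro ⟨S, S'⟩ h
    simp only [Finset.mem_sigma, Finset.mem_powersetCard, Finset.subset_sdiff] at h
    obtain ⟨⟨h1, rfl⟩, ⟨h2, h3⟩, rfl⟩ := h
    have hU : (S ∪ S') \ S = S' := Finset.union_sdiff_cancel_left h3.symm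
    have hA : (A \ S) \ S' = A \ (S ∪ S') := sdiff_sdiff_left
    have hA' : (A \ S') \ S = A \ (S ∪ S') := by rw [sdiff_sdiff_left, Finset.union_comm]; rfl
    simp only [hU]
    rw [crossProd_sdiff_left (Finset.subset_union_left : S ⊆ S ∪ S'), hU, hA,
      crossProd_sdiff_right (S := S) (A := A \ S) (U := S') (Finset.subset_sdiff.2 ⟨h2, h3⟩), hA]
    ring

/-- Since `ω = ε · f` on each cross pair, the `ε` factors assemble into `ε(U)`, which does not
depend on `S`. -/
theorem sum_epsSet_mul_crossProd {q t : L} (ht : t ≠ 0) {z : ι → L} (hz : Generic t⁻¹ z)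
    (U : Finset ι) (a : ℕ) :
    ∑ S ∈ U.powersetCard a, epsSet t z S * epsSet t z (U \ S) * crossProd q t z S (U \ S) =
      epsSet t z U * ratioSum q t⁻¹ z U fun k _ => if k = a then 1 else 0 := by
  rw [ratioSum, Finset.mul_sum, Finset.powersetCard_eq_filter, Finset.sum_filter]
  refine Finset.sum_congr rfl fun S hS => ?_
  rw [Finset.mem_powerset] at hS
  split_ifs with h
  · conv_rhs => rw [epsSet, ← Finset.union_sdiff_of_subset hS,
      pairProd_union (fun i j => epsFactor_symm ht _ _) Finset.disjoint_sdiff]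
    rw [epsSet, epsSet, one_mul, mul_assoc _ (∏ i ∈ S, _), ratioProd,
      Finset.union_sdiff_of_subset hS, ← Finset.prod_mul_distrib, crossProd]
    congr 1
    refine Finset.prod_congr rfl fun i hi => ?_
    rw [← Finset.prod_mul_distrib]
    refine Finset.prod_congr rfl fun j hj => ?_
    have hij : i ≠ j := by
      rintro rfl
      exact (Finset.mem_sdiff.1 hj).2 hi
    exact (epsFactor_mul_ratioFactor (hz.ne i j hij) (hz.ne_mul i j hij)).symm
  · simp

theorem listSum_swap {q t : L} (hq : q ≠ 0) (ht : t ≠ 0) (ht2 : t ^ 2 ≠ 1) {z : ι → L}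
    (hz : Generic t⁻¹ z) (A : Finset ι) (a b : ℕ) (l : List ℕ) :
    listSum q t z A (a :: b :: l) = listSum q t z A (b :: a :: l) := by
  rw [listSum_cons_cons, listSum_cons_cons, add_comm b a]
  refine Finset.sum_congr rfl fun U hU => ?_
  congr 1
  rw [sum_epsSet_mul_crossProd ht hz, sum_epsSet_mul_crossProd ht hz,
    ratioSum_swap hq (inv_ne_zero ht) (by rwa [inv_pow, ne_eq, inv_eq_one]) hz]
  congr 1
  refine Finset.sum_congr rfl fun S hS => ?_
  have h1 := Finset.card_sdiff_add_card_eq_card (Finset.mem_powerset.1 hS)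
  rw [(Finset.mem_powersetCard.1 hU).2] at h1
  -- As `|U| = a + b`, transposing the weight "first block has size `a`" gives "first block has size
  -- `b`".
  have : ((U \ S).card = a) = (S.card = b) := by
    apply propext
    omega
  simp only [this]

theorem listSum_perm {q t : L} (hq : q ≠ 0) (ht : t ≠ 0) (ht2 : t ^ 2 ≠ 1) {z : ι → L}
    (hz : Generic t⁻¹ z) {l l' : List ℕ} (h : l.Perm l') (A : Finset ι) :
    listSum q t z A l = listSum q t z A l' := by
  induction h generalizing A with
  | nil => rfl
  | cons a _ ih => simp only [listSum, ih]
  | swap a b l => exact listSum_swap hq ht ht2 hz A _ _ _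
  | trans _ _ ih1 ih2 => rw [ih1, ih2]

/-- The exponents of `x^d` may be zero while partitions have positive parts; an empty block
contributes the factor `1`. -/
theorem listSum_filter (q t : L) (z : ι → L) (A : Finset ι) (l : List ℕ) :
    listSum q t z A (l.filter (· ≠ 0)) = listSum q t z A l := by
  induction l generalizing A with
  | nil => rfl
  | cons a l ih =>
    rcases eq_or_ne a 0 with rfl | ha
    · simpa [listSum, epsSet, pairProd, crossProd] using ih A
    · rw [List.filter_cons_of_pos (by simpa using ha)]
      simp only [listSum, ih]

end ListSum

/-! ### The right-hand side: maps to colours as ordered set partitions -/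

section Coloring

variable {L : Type*} [Field L] {n m : ℕ}

/-- The three values of `γ` are compatible with exchanging both the colours and the variables, so a
product over pairs of positions can be reordered by colour. -/
theorem gamma_symm {q t : L} (hq : q ≠ 0) (ht : t ≠ 0) (i j : Fin m) (x y : L) :
    gamma q t i j x y = gamma q t j i y x := by
  rcases lt_trichotomy i j with h | rfl | h
  · rw [gamma, gamma, if_neg h.ne, if_pos h, if_neg h.ne', if_neg h.not_gt,
      show (y - x) ^ 3 = - (x - y) ^ 3 by ring, div_neg, ← neg_div]
    congr 1
    field_simp
    ring
  · simpa [gamma, epsFactor] using epsFactor_symm ht x y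
  · rw [gamma, gamma, if_neg h.ne', if_neg h.not_gt, if_neg h.ne, if_pos h,
      show (y - x) ^ 3 = - (x - y) ^ 3 by ring, div_neg, ← neg_div]
    congr 1
    field_simp
    ring

/-- The maps `Fin n → Fin m` which agree with `c` outside `A`, take values `≥ k` on `A`, and take
each value `j ≥ k` exactly `d j` times on `A`. -/
def colorings (d : Fin m → ℕ) (A : Finset (Fin n)) (k : ℕ) (c : Fin n → Fin m) :
    Finset (Fin n → Fin m) :=
  Finset.univ.filter fun i => (∀ α ∉ A, i α = c α) ∧ (∀ α ∈ A, k ≤ (i α : ℕ)) ∧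
    ∀ j : Fin m, k ≤ (j : ℕ) → (A.filter fun α => i α = j).card = d j

theorem mem_colorings {d : Fin m → ℕ} {A : Finset (Fin n)} {k : ℕ} {c i : Fin n → Fin m} :
    i ∈ colorings d A k c ↔ (∀ α ∉ A, i α = c α) ∧ (∀ α ∈ A, k ≤ (i α : ℕ)) ∧
      ∀ j : Fin m, k ≤ (j : ℕ) → (A.filter fun α => i α = j).card = d j := by
  simp [colorings]

/-- Peels off one colour: once the fibre `S` of `k` is prescribed, what remains is a colouring of `A
\ S` by larger colours. Fixing the values outside the active set, through `c`, makes this an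
equality of sets of maps and not merely a bijection. -/
theorem colorings_filter (d : Fin m → ℕ) (A : Finset (Fin n)) (k : Fin m) (c : Fin n → Fin m)
    {S : Finset (Fin n)} (hS : S ∈ A.powersetCard (d k)) :
    (colorings d A k c).filter (fun i => (A.filter fun α => i α = k) = S) =
      colorings d (A \ S) (k + 1) fun α => if α ∈ S then k else c α := by
  rw [Finset.mem_powersetCard] at hS
  ext i
  rw [Finset.mem_filter, mem_colorings, mem_colorings]
  constructor
  · rintro ⟨⟨h1, h2, h3⟩, h4⟩
    have hk : ∀ α ∈ A \ S, i α ≠ k := fun α hα hik => by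
      rw [Finset.mem_sdiff] at hα
      exact hα.2 (h4 ▸ Finset.mem_filter.2 ⟨hα.1, hik⟩)
    refine ⟨fun α hα => ?_, fun α hα => ?_, fun j hj => ?_⟩
    · split_ifs with hαS
      · rw [← h4] at hαS
        exact (Finset.mem_filter.1 hαS).2
      · exact h1 α fun h => hα (Finset.mem_sdiff.2 ⟨h, hαS⟩)
    · have := h2 α (Finset.sdiff_subset hα)
      have h5 : (i α : ℕ) ≠ k := fun h => hk α hα (Fin.ext h)
      omega
    · rw [← h3 j (by omega)]
      congr 1
      ext α
      simp only [Finset.mem_filter, Finset.mem_sdiff]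
      constructor
      · rintro ⟨⟨h5, _⟩, h6⟩
        exact ⟨h5, h6⟩
      · rintro ⟨h5, rfl⟩
        refine ⟨⟨h5, fun h6 => ?_⟩, rfl⟩
        rw [← h4] at h6
        rw [(Finset.mem_filter.1 h6).2] at hj
        omega
  · rintro ⟨h1, h2, h3⟩
    have hSk : ∀ α ∈ S, i α = k := fun α hα => by
      rw [h1 α (by simp [hα]), if_pos hα]
    have h4 : (A.filter fun α => i α = k) = S := by
      ext α
      rw [Finset.mem_filter]
      constructor
      · rintro ⟨h5, h6⟩
        by_contra h7
        have := h2 α (Finset.mem_sdiff.2 ⟨h5, h7⟩)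
        rw [h6] at this
        omega
      · exact fun h => ⟨hS.1 h, hSk α h⟩
    refine ⟨⟨fun α hα => ?_, fun α hα => ?_, fun j hj => ?_⟩, h4⟩
    · rw [h1 α (by simp [hα]), if_neg fun h => hα (hS.1 h)]
    · by_cases h5 : α ∈ S
      · rw [hSk α h5]
      · have := h2 α (Finset.mem_sdiff.2 ⟨hα, h5⟩)
        omega
    · rcases eq_or_ne j k with rfl | hjk
      · rw [h4, hS.2]
      · have : (j : ℕ) ≠ k := fun h => hjk (Fin.ext h)
        rw [← h3 j (by omega)]
        congr 1
        ext α
        simp only [Finset.mem_filter, Finset.mem_sdiff]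
        constructor
        · rintro ⟨h5, rfl⟩
          exact ⟨⟨h5, fun h6 => hjk (hSk α h6)⟩, rfl⟩
        · rintro ⟨⟨h5, _⟩, h6⟩
          exact ⟨h5, h6⟩

/-- Descending induction on the least allowed colour: the fibre of `k` is the first block, with `γ =
ε` inside it and `γ = ω` from it to all larger colours. -/
theorem sum_colorings {q t : L} (hq : q ≠ 0) (ht : t ≠ 0) (z : Fin n → L) (d : Fin m → ℕ)
    (k : ℕ) (hk : k ≤ m) (A : Finset (Fin n)) (c : Fin n → Fin m) :
    ∑ i ∈ colorings d A k c, pairProd (fun α β => gamma q t (i α) (i β) (z α) (z β)) A =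
      listSum q t z A ((List.ofFn d).drop k) := by
  induction hk using Nat.decreasingInduction generalizing A c with
  | self =>
    -- No colour is left, so a colouring exists only when `A` is empty, as in the base case of
    -- `listSum`.
    rw [List.drop_of_length_le (by simp), listSum]
    split_ifs with hA
    · subst hA
      have : colorings d (∅ : Finset (Fin n)) m c = {c} := by
        ext i
        rw [mem_colorings, Finset.mem_singleton]
        constructor
        · exact fun h => funext fun α => h.1 α (Finset.notMem_empty α)
        · rintro rfl
          refine ⟨by simp, by simp, fun j hj => ?_⟩
          omega
      rw [this, Finset.sum_singleton]
      simp [pairProd]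
    · obtain ⟨α, hα⟩ := Finset.nonempty_iff_ne_empty.2 hA
      apply Finset.sum_eq_zero
      intro i hi
      have := (mem_colorings.1 hi).2.1 α hα
      omega
  | of_succ k hk ih =>
    rw [List.drop_eq_getElem_cons (by simpa using hk), listSum, List.getElem_ofFn,
      ← Finset.sum_fiberwise_of_maps_to (s := colorings d A k c)
        (g := fun i => A.filter fun α => i α = ⟨k, hk⟩)]
    · refine Finset.sum_congr rfl fun S hS => ?_
      have hSA := (Finset.mem_powersetCard.1 hS).1
      rw [colorings_filter d A ⟨k, hk⟩ c hS, ← ih (A \ S) fun α => if α ∈ S then ⟨k, hk⟩ else c α,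
        Finset.mul_sum]
      refine Finset.sum_congr rfl fun i hi => ?_
      obtain ⟨h1, h2, h3⟩ := mem_colorings.1 hi
      have hSk : ∀ α ∈ S, i α = ⟨k, hk⟩ := fun α hα => by
        rw [h1 α (by simp [hα]), if_pos hα]
      conv_lhs => rw [← Finset.union_sdiff_of_subset hSA,
        pairProd_union (fun α β => gamma_symm hq ht _ _ _ _) Finset.disjoint_sdiff]
      have e1 : pairProd (fun α β => gamma q t (i α) (i β) (z α) (z β)) S = epsSet t z S :=
        pairProd_congr fun α hα β hβ => by rw [hSk α hα, hSk β hβ, gamma, if_pos rfl, epsFactor]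
      have e2 : ∏ α ∈ S, ∏ β ∈ A \ S, gamma q t (i α) (i β) (z α) (z β) =
          crossProd q t z S (A \ S) := by
        refine Finset.prod_congr rfl fun α hα => Finset.prod_congr rfl fun β hβ => ?_
        have hlt : i α < i β := by
          rw [hSk α hα, Fin.lt_def]
          exact h2 β hβ
        rw [gamma, if_neg hlt.ne, if_pos hlt, omega]
      rw [e1, e2]
      ring
    · intro i hi
      rw [Finset.mem_powersetCard]
      exact ⟨Finset.filter_subset _ _, (mem_colorings.1 hi).2.2 ⟨k, hk⟩ le_rfl⟩

end Coloring

/-! ### Permutations grouped by the image of a subset -/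

section Counting

theorem exists_perm_map_eq {ι : Type*} [Fintype ι] [DecidableEq ι] {J S : Finset ι}
    (h : S.card = J.card) : ∃ τ : Equiv.Perm ι, J.map τ.toEmbedding = S := by
  have e : {x // x ∈ J} ≃ {x // x ∈ S} := Fintype.equivOfCardEq (by simp [h])
  refine ⟨e.extendSubtype, Finset.eq_of_subset_of_card_le ?_ (by simp [h])⟩
  intro x hx
  obtain ⟨y, hy, rfl⟩ := Finset.mem_map.1 hx
  exact e.extendSubtype_mem y hy

/-- Left multiplication by a permutation carrying `J` to `S` identifies the fibres, so they are
equinumerous; dividing `n!` by the number `n.choose |J|` of fibres gives their size. -/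
theorem card_perm_map_eq {ι : Type*} [Fintype ι] [DecidableEq ι] {J S : Finset ι}
    (h : S.card = J.card) :
    (Finset.univ.filter fun σ : Equiv.Perm ι => J.map σ.toEmbedding = S).card =
      J.card.factorial * (Fintype.card ι - J.card).factorial := by
  have hconst : ∀ S : Finset ι, S.card = J.card →
      (Finset.univ.filter fun σ : Equiv.Perm ι => J.map σ.toEmbedding = S).card =
        (Finset.univ.filter fun σ : Equiv.Perm ι => J.map σ.toEmbedding = J).card := by
    intro S hS
    obtain ⟨τ, hτ⟩ := exists_perm_map_eq hS
    symm
    refine Finset.card_bij' (fun σ _ => τ * σ) (fun σ _ => τ⁻¹ * σ) ?_ ?_ (by simp) (by simp)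
    · intro σ hσ
      rw [Finset.mem_filter] at hσ ⊢
      refine ⟨Finset.mem_univ _, ?_⟩
      rw [← hτ]
      conv_rhs => rw [← hσ.2]
      rw [Finset.map_map]
      rfl
    · intro σ hσ
      rw [Finset.mem_filter] at hσ ⊢
      refine ⟨Finset.mem_univ _, ?_⟩
      have h1 : J.map (τ⁻¹ * σ).toEmbedding = (J.map σ.toEmbedding).map (τ⁻¹).toEmbedding := by
        rw [Finset.map_map]; rfl
      rw [h1, hσ.2, ← hτ, Finset.map_map]
      convert Finset.map_refl
      ext x
      simp
  have htot := Finset.card_eq_sum_card_fiberwise (s := (Finset.univ : Finset (Equiv.Perm ι)))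
    (f := fun σ => J.map σ.toEmbedding) (t := Finset.univ.powersetCard J.card)
    (by intro σ _; simp [Finset.mem_powersetCard])
  rw [Finset.sum_congr rfl fun S hS => hconst S (Finset.mem_powersetCard.1 hS).2,
    Finset.sum_const, Finset.card_powersetCard, Finset.card_univ, Finset.card_univ,
    Fintype.card_perm, smul_eq_mul] at htot
  rw [hconst S h]
  have hle : J.card ≤ Fintype.card ι := Finset.card_le_univ J
  have := Nat.choose_mul_factorial_mul_factorial hle
  rw [htot, mul_assoc] at this
  exact (Nat.eq_of_mul_eq_mul_left (Nat.choose_pos hle) this).symm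

theorem sum_perm_map {ι L : Type*} [Fintype ι] [DecidableEq ι] [Semiring L] (J : Finset ι)
    (H : Finset ι → L) : ∑ σ : Equiv.Perm ι, H (J.map σ.toEmbedding) =
      ((J.card.factorial * (Fintype.card ι - J.card).factorial : ℕ) : L) *
        ∑ S ∈ Finset.univ.powersetCard J.card, H S := by
  rw [← Finset.sum_fiberwise_of_maps_to (s := Finset.univ) (t := Finset.univ.powersetCard J.card)
    (g := fun σ : Equiv.Perm ι => J.map σ.toEmbedding) (by intro σ _; simp), Finset.mul_sum]
  refine Finset.sum_congr rfl fun S hS => ?_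
  rw [Finset.sum_congr rfl fun σ hσ => congrArg H (Finset.mem_filter.1 hσ).2, Finset.sum_const,
    card_perm_map_eq (Finset.mem_powersetCard.1 hS).2, nsmul_eq_mul]

end Counting

/-! ### Star products of the `ε_r` as sums over ordered set partitions -/

section Star

variable {K : Type*} [Field K]

theorem renameRat_algebraMap_poly {σ τ : Type*} (f : σ ↪ τ) (a : MvPolynomial σ K) :
    renameRat f (algebraMap _ (RatFn K σ) a) = algebraMap _ (RatFn K τ) (MvPolynomial.rename f a) := by
  rw [renameRat, IsFractionRing.liftAlgHom_apply, IsFractionRing.lift_algebraMap]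
  rfl

theorem renameRat_renameRat {σ τ υ : Type*} (f : σ ↪ τ) (g : τ ↪ υ) (x : RatFn K σ) :
    renameRat g (renameRat f x) = renameRat (f.trans g) x := by
  obtain ⟨a, b, _, rfl⟩ := IsFractionRing.div_surjective (A := MvPolynomial σ K) x
  simp only [map_div₀, renameRat_algebraMap_poly, MvPolynomial.rename_rename]
  rfl

theorem zvar_injective {σ : Type*} : Function.Injective (zvar K (σ := σ)) :=
  (IsFractionRing.injective _ _).comp MvPolynomial.X_injective

theorem zvar_ne_mul {σ : Type*} {i j : σ} (h : i ≠ j) (c : K) :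
    zvar K i ≠ algebraMap K (RatFn K σ) c * zvar K j := by
  intro h0
  rw [zvar, zvar, IsScalarTower.algebraMap_apply K (MvPolynomial σ K) (RatFn K σ), ← map_mul] at h0
  have h1 := IsFractionRing.injective (MvPolynomial σ K) (RatFn K σ) h0
  have h2 := congrArg (MvPolynomial.coeff (Finsupp.single i 1)) h1
  classical
  rw [MvPolynomial.algebraMap_eq, MvPolynomial.coeff_C_mul, MvPolynomial.coeff_X,
    MvPolynomial.coeff_X, if_pos rfl, if_neg, mul_zero] at h2
  · exact one_ne_zero h2
  · intro h3
    exact h (Finsupp.single_left_injective one_ne_zero h3).symm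

/-- Independent variables are never proportional over `K`, which gives the genericity required by
the interpolation. -/
theorem generic_zvar {σ : Type*} (p : K) :
    Generic (algebraMap K (RatFn K σ) p) (zvar K (σ := σ)) where
  ne_zero i h := MvPolynomial.X_ne_zero (R := K) i
    ((map_eq_zero_iff _ (IsFractionRing.injective (MvPolynomial σ K) (RatFn K σ))).1 h)
  ne i j h h' := h (zvar_injective h')
  ne_mul i j h := zvar_ne_mul h p
  ne_sq_mul i j h := by
    rw [← map_pow]
    exact zvar_ne_mul h _

theorem charZero_ratFn (K : Type*) [Field K] [CharZero K] (σ : Type*) : CharZero (RatFn K σ) :=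
  charZero_of_injective_algebraMap (algebraMap K (RatFn K σ)).injective

variable {σ : Type*} [LinearOrder σ]

theorem renameRat_eps {p : K} (hp : p ≠ 0) {n : ℕ} (e : Fin n ↪ σ) :
    renameRat e (eps p n) =
      epsSet (algebraMap K (RatFn K σ) p) (zvar K) (Finset.univ.map e) := by
  rw [epsSet, pairProd_map (fun i j => epsFactor_symm (by simpa using hp) _ _), eps, pairProd]
  simp only [map_prod, map_div₀, map_mul, map_sub, map_pow, renameRat_zvar, AlgHom.commutes]
  refine Finset.prod_congr rfl fun i _ => ?_
  rw [← Finset.prod_filter]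
  refine Finset.prod_congr ?_ fun j _ => ?_
  · ext j; simp
  · rw [epsFactor, map_inv₀]

/-- The symmetrized term depends on a permutation only through the image of the first `a` variables,
so each `a`-subset occurs `a! b!` times. The hypothesis quantifies over all embeddings because the
last `b` variables are sent to arbitrary places; it says that `G` is symmetric up to the scalar `r`,
which collects earlier normalizations. -/
theorem renameRat_starProd_eps {q t : K} (ht : t ≠ 0) {a b : ℕ} {G : RatFn K (Fin b)}
    {r : RatFn K σ} {H : Finset σ → RatFn K σ}
    (hG : ∀ e : Fin b ↪ σ, renameRat e G = r * H (Finset.univ.map e)) (e : Fin (a + b) ↪ σ) :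
    renameRat e (starProd q t (eps t a) G) =
      (a.factorial * b.factorial : RatFn K σ) / ((a + b).factorial : RatFn K σ) * r *
        ∑ S ∈ (Finset.univ.map e).powersetCard a,
          epsSet (algebraMap K (RatFn K σ) t) (zvar K) S *
          crossProd (algebraMap K (RatFn K σ) q) (algebraMap K (RatFn K σ) t) (zvar K) S
            (Finset.univ.map e \ S) * H (Finset.univ.map e \ S) := by
  set J : Finset (Fin (a + b)) := Finset.univ.map (Fin.castAddEmb b) with hJ
  have hJc : Finset.univ.map (Fin.natAddEmb a) = Finset.univ \ J := by
    ext x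
    simp only [hJ, Finset.mem_map, Finset.mem_univ, true_and, Finset.mem_sdiff]
    constructor
    · rintro ⟨y, rfl⟩ ⟨x, hx⟩
      have := congrArg Fin.val hx
      simp at this
      omega
    · intro hx
      induction x using Fin.addCases with
      | left i => exact absurd ⟨i, rfl⟩ hx
      | right i => exact ⟨i, rfl⟩
  have hJa : J.card = a := by simp [hJ]
  have key : ∀ σ' : Equiv.Perm (Fin (a + b)),
      renameRat e (renameRat σ'.toEmbedding (renameRat (Fin.castAddEmb b) (eps t a) *
        renameRat (Fin.natAddEmb a) G * ∏ α : Fin a, ∏ β : Fin b,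
          omega (algebraMap K (RatFn K (Fin (a + b))) q⁻¹) (algebraMap K (RatFn K (Fin (a + b))) t)
            (algebraMap K (RatFn K (Fin (a + b))) (q * t⁻¹))
            (zvar K (Fin.castAdd b α)) (zvar K (Fin.natAdd a β)))) =
      (fun S : Finset (Fin (a + b)) => epsSet (algebraMap K (RatFn K σ) t) (zvar K) (S.map e) *
          crossProd (algebraMap K (RatFn K σ) q) (algebraMap K (RatFn K σ) t) (zvar K) (S.map e)
            (Finset.univ.map e \ S.map e) * (r * H (Finset.univ.map e \ S.map e)))
        (J.map σ'.toEmbedding) := by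
    intro σ'
    have h1 : (J.map σ'.toEmbedding).map e =
        Finset.univ.map ((Fin.castAddEmb b).trans (σ'.toEmbedding.trans e)) := by
      rw [hJ, Finset.map_map, Finset.map_map]
    have h2 : Finset.univ.map e \ (J.map σ'.toEmbedding).map e =
        Finset.univ.map ((Fin.natAddEmb a).trans (σ'.toEmbedding.trans e)) := by
      rw [← Finset.map_map, hJc, Finset.map_sdiff, ← Finset.map_map, ← Finset.map_map]
      congr 2
      simp
    simp only [h2]
    simp only [h1]
    rw [renameRat_renameRat, map_mul, map_mul, renameRat_renameRat, renameRat_renameRat,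
      renameRat_eps ht, hG, crossProd]
    simp only [map_prod, Finset.prod_map, omega, map_div₀, map_mul, map_sub, map_pow,
      renameRat_zvar, AlgHom.commutes, map_inv₀]
    simp only [Function.Embedding.trans_apply, Fin.castAddEmb_apply, Fin.natAddEmb_apply]
    ring
  rw [starProd, symmetrize, map_mul, map_sum, Finset.sum_congr rfl fun σ' _ => key σ',
    sum_perm_map J fun S : Finset (Fin (a + b)) =>
      epsSet (algebraMap K (RatFn K σ) t) (zvar K) (S.map e) *
          crossProd (algebraMap K (RatFn K σ) q) (algebraMap K (RatFn K σ) t) (zvar K) (S.map e)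
            (Finset.univ.map e \ S.map e) * (r * H (Finset.univ.map e \ S.map e)),
    Finset.powersetCard_map, Finset.sum_map, hJa, Fintype.card_fin, Nat.add_sub_cancel_left,
    map_inv₀, map_natCast, Finset.mul_sum, Finset.mul_sum, Finset.mul_sum]
  refine Finset.sum_congr rfl fun S _ => ?_
  have hS : (Finset.mapEmbedding e).toEmbedding S = S.map e := rfl
  rw [hS]
  push_cast
  ring

/-- The factors `a! b! / (a + b)!` telescope to the inverse of the multinomial coefficient that
appears in `F_λ`. -/
theorem renameRat_epsList [CharZero K] {q t : K} (ht : t ≠ 0) (l : List ℕ) (e : Fin l.sum ↪ σ) :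
    renameRat e (epsList q t t l) =
      ((l.map Nat.factorial).prod : RatFn K σ) / (l.sum.factorial : RatFn K σ) *
        listSum (algebraMap K (RatFn K σ) q) (algebraMap K (RatFn K σ) t) (zvar K)
          (Finset.univ.map e) l := by
  induction l with
  | nil =>
    have : IsEmpty (Fin ([] : List ℕ).sum) := inferInstanceAs (IsEmpty (Fin 0))
    have h1 : renameRat e (epsList q t t []) = 1 := map_one (renameRat e)
    have h2 : Finset.univ.map e = ∅ := by rw [Finset.univ_eq_empty, Finset.map_empty]
    rw [h1, listSum, if_pos h2]
    simp
  | cons a l ih =>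
    have h := renameRat_starProd_eps (q := q) ht (b := l.sum)
      (H := fun A => listSum (algebraMap K (RatFn K σ) q) (algebraMap K (RatFn K σ) t) (zvar K) A l)
      ih (a := a) e
    refine h.trans ?_
    have := charZero_ratFn K σ
    have h1 : (l.sum.factorial : RatFn K σ) ≠ 0 := Nat.cast_ne_zero.2 (Nat.factorial_ne_zero _)
    have h2 : ((a :: l).sum.factorial : RatFn K σ) = ((a + l.sum).factorial : RatFn K σ) := rfl
    rw [listSum, List.map_cons, List.prod_cons, Nat.cast_mul, h2]
    congr 1
    field_simp

end Star

/-! ### Newton's identity for `g_n` and its derivatives in the power sums -/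

section Newton

variable {K : Type*} [Field K]

/-- The coefficient of `p_n` in Newton's identity for the `g_n`. -/
def newtonCoeff (q t : K) (n : ℕ) : K := (1 - t ^ n) / (1 - q ^ n)

/-- By the convention `0 / 0 = 0`. It makes the `k = 0` terms of the Newton sums below harmless. -/
theorem newtonCoeff_zero (q t : K) : newtonCoeff q t 0 = 0 := by simp [newtonCoeff]

theorem X_mul_derivative_rescale (a : K) (f : PowerSeries K) :
    PowerSeries.X * PowerSeries.derivative K (PowerSeries.rescale a f) =
      PowerSeries.rescale a (PowerSeries.X * PowerSeries.derivative K f) := by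
  ext n
  cases n with
  | zero => simp
  | succ n =>
    rw [PowerSeries.coeff_succ_X_mul, PowerSeries.coeff_rescale, PowerSeries.coeff_succ_X_mul,
      PowerSeries.coeff_derivative, PowerSeries.coeff_derivative, PowerSeries.coeff_rescale, mul_assoc]

/-- The coefficients of `P(X) - P(qX)` are `1 - t ^ n`, so this difference is `1/(1 - X) - 1/(1 -
tX)`. -/
theorem newtonSeries_functional {q : K} (hq : ∀ k, 0 < k → q ^ k ≠ 1) (t : K) :
    (1 - PowerSeries.X) * (1 - PowerSeries.C t * PowerSeries.X) *
      (PowerSeries.mk (newtonCoeff q t) - PowerSeries.rescale q (PowerSeries.mk (newtonCoeff q t))) =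
        (1 - PowerSeries.C t) * PowerSeries.X := by
  have h : PowerSeries.mk (newtonCoeff q t) -
      PowerSeries.rescale q (PowerSeries.mk (newtonCoeff q t)) =
        PowerSeries.mk 1 - PowerSeries.rescale t (PowerSeries.mk 1) := by
    ext n
    rw [map_sub, map_sub, PowerSeries.coeff_rescale, PowerSeries.coeff_rescale, PowerSeries.coeff_mk,
      PowerSeries.coeff_mk]
    rcases Nat.eq_zero_or_pos n with rfl | hn
    · simp [newtonCoeff_zero]
    · have : 1 - q ^ n ≠ 0 := sub_ne_zero.2 (hq n hn).symm
      rw [newtonCoeff, Pi.one_apply]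
      field_simp
  have h1 : PowerSeries.mk (1 : ℕ → K) * (1 - PowerSeries.X) = 1 := PowerSeries.mk_one_mul_one_sub_eq_one K
  have h2 := congrArg (PowerSeries.rescale t) h1
  rw [map_mul, map_sub, map_one, PowerSeries.rescale_X] at h2
  rw [h]
  linear_combination (1 - PowerSeries.C t * PowerSeries.X) * h1 - (1 - PowerSeries.X) * h2

/-- The logarithmic derivative of the `q`-binomial series, obtained without logarithms: the defect
`E = X B' - P B` satisfies the same `q`-difference equation as `B` but has zero constant term, and
`1 - q ^ (n+1) ≠ 0` then forces `E = 0`. -/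
theorem X_mul_derivative_qBinomialSeries {q : K} (hq : ∀ k, 0 < k → q ^ k ≠ 1) (t : K) :
    PowerSeries.X * PowerSeries.derivative K (qBinomialSeries q t) =
      PowerSeries.mk (newtonCoeff q t) * qBinomialSeries q t := by
  set B := qBinomialSeries q t with hB
  set P := PowerSeries.mk (newtonCoeff q t) with hP
  set E := PowerSeries.X * PowerSeries.derivative K B - P * B with hE
  have hfun := qBinomialSeries_functional hq t
  rw [← hB] at hfun
  have hder := congrArg (fun f => PowerSeries.X * PowerSeries.derivative K f) hfun
  simp only [Derivation.leibniz, map_sub, Derivation.map_one_eq_zero, smul_eq_mul,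
    PowerSeries.derivative_X, PowerSeries.derivative_C] at hder
  have hres := X_mul_derivative_rescale q B
  have hPf := newtonSeries_functional hq t
  rw [← hP] at hPf
  have hE' : PowerSeries.rescale q E =
      PowerSeries.X * PowerSeries.derivative K (PowerSeries.rescale q B) -
        PowerSeries.rescale q P * PowerSeries.rescale q B := by
    rw [hE, map_sub, ← hres, map_mul]
  have hEq : (1 - PowerSeries.X) * E =
      (1 - PowerSeries.C t * PowerSeries.X) * PowerSeries.rescale q E := by
    -- The extra factor `1 - X` is needed because `newtonSeries_functional` is stated with the
    -- denominator `(1 - X)(1 - tX)` cleared.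
    have hX : (1 - PowerSeries.X : PowerSeries K) ≠ 0 := fun h => by
      have := congrArg (PowerSeries.coeff 0) h
      simp at this
    refine mul_left_cancel₀ hX ?_
    rw [hE', hE]
    linear_combination (1 - PowerSeries.X) * hder + (PowerSeries.X - (1 - PowerSeries.X) * P) * hfun -
      PowerSeries.rescale q B * hPf
  have hcoef : ∀ n, E.coeff n = 0 := by
    intro n
    induction n with
    | zero => simp [hE, hP, newtonCoeff_zero]
    | succ n ih =>
      have := congrArg (PowerSeries.coeff (n + 1)) hEq
      simp only [sub_mul, one_mul, map_sub, PowerSeries.coeff_succ_X_mul, mul_assoc,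
        PowerSeries.coeff_C_mul, PowerSeries.coeff_rescale, ih] at this
      have h1 : 1 - q ^ (n + 1) ≠ 0 := sub_ne_zero.2 (hq _ n.succ_pos).symm
      refine (mul_eq_zero.1 (?_ : (1 - q ^ (n + 1)) * _ = 0)).resolve_left h1
      linear_combination this
  exact sub_eq_zero.1 (PowerSeries.ext fun n => by rw [hcoef, map_zero])

theorem natCast_mul_coeff_qBinomialSeries {q : K} (hq : ∀ k, 0 < k → q ^ k ≠ 1) (t : K) (n : ℕ) :
    (n : K) * (qBinomialSeries q t).coeff n = ∑ k ∈ Finset.range (n + 1),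
      newtonCoeff q t k * (qBinomialSeries q t).coeff (n - k) := by
  have h := congrArg (PowerSeries.coeff n) (X_mul_derivative_qBinomialSeries hq t)
  rw [PowerSeries.coeff_mul _ (PowerSeries.mk _), Finset.Nat.sum_antidiagonal_eq_sum_range_succ_mk] at h
  simp only [PowerSeries.coeff_mk] at h
  rw [← h]
  cases n with
  | zero => simp
  | succ n => rw [PowerSeries.coeff_succ_X_mul, PowerSeries.coeff_derivative]; push_cast; ring

theorem coeff_powerSumSeries_mul {R : Type*} [CommSemiring R] {k : ℕ} (hk : k ≠ 0)
    (f : MvPowerSeries ℕ R) (d : ℕ →₀ ℕ) :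
    (powerSumSeries R k * f).coeff d =
      ∑ i ∈ d.support, if k ≤ d i then f.coeff (d - Finsupp.single i k) else 0 := by
  classical
  rw [MvPowerSeries.coeff_mul, ← Finset.sum_filter]
  symm
  refine Finset.sum_of_injOn (fun i => (Finsupp.single i k, d - Finsupp.single i k)) ?_ ?_ ?_ ?_
  · intro i _ j _ h
    exact Finsupp.single_left_injective hk (Prod.ext_iff.1 h).1
  · intro i hi
    rw [Finset.mem_coe, Finset.mem_filter] at hi
    rw [Finset.mem_coe, Finset.HasAntidiagonal.mem_antidiagonal]
    exact add_tsub_cancel_of_le (Finsupp.single_le_iff.2 hi.2)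
  · rintro ⟨a, b⟩ hab hni
    rw [Finset.HasAntidiagonal.mem_antidiagonal] at hab
    simp only at hab
    rw [powerSumSeries, coeff_ofCoeff, if_neg, zero_mul]
    rintro ⟨i, hi⟩
    simp only at hi
    subst hi
    apply hni
    refine ⟨i, ?_, ?_⟩
    · have : k ≤ d i := by rw [← hab]; simp
      rw [Finset.mem_coe, Finset.mem_filter, Finsupp.mem_support_iff]
      exact ⟨by omega, this⟩
    · simp only [Prod.mk.injEq, true_and]
      rw [← hab, add_tsub_cancel_left]
  · intro i _
    rw [powerSumSeries, coeff_ofCoeff, if_pos ⟨i, rfl⟩, one_mul]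

theorem prod_sub_single {R : Type*} [CommSemiring R] {B : ℕ → R} (hB : B 0 = 1) {d : ℕ →₀ ℕ} {i : ℕ}
    (hi : i ∈ d.support) (k : ℕ) : (d - Finsupp.single i k).prod (fun _ n => B n) =
      (∏ j ∈ d.support.erase i, B (d j)) * B (d i - k) := by
  rw [Finsupp.prod_of_support_subset _ (Finsupp.support_tsub : _ ⊆ d.support) _ fun _ _ => hB,
    ← Finset.prod_erase_mul _ _ hi]
  congr 1
  · refine Finset.prod_congr rfl fun j hj => ?_
    simp [(Finset.ne_of_mem_erase hj).symm]
  · simp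

theorem coeff_g (q t : K) (n : ℕ) (d : ℕ →₀ ℕ) : (g q t n : MvPowerSeries ℕ K).coeff d =
    if d.degree = n then d.prod fun _ k => (qBinomialSeries q t).coeff k else 0 := by
  rw [g, MvPowerSeries.coeff_homogeneousComponent, gSeries, coeff_ofCoeff]

theorem coeff_zero_qBinomialSeries (q t : K) : (qBinomialSeries q t).coeff 0 = 1 := by
  simp [qBinomialSeries]

/-- The coefficients of the generating product factor over the variables; apply the one-variable
identity to each exponent `d i` and add up, using `∑ d i = n`. -/
theorem natCast_smul_g {q : K} (hq : ∀ k, 0 < k → q ^ k ≠ 1) (t : K) (n : ℕ) :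
    (n : K) • (g q t n : MvPowerSeries ℕ K) = ∑ k ∈ Finset.range (n + 1),
      newtonCoeff q t k • (powerSumSeries K k * (g q t (n - k) : MvPowerSeries ℕ K)) := by
  ext d
  rw [map_sum, map_smul, coeff_g, smul_eq_mul]
  have hterm : ∀ k ∈ Finset.range (n + 1), (newtonCoeff q t k • (powerSumSeries K k *
      (g q t (n - k) : MvPowerSeries ℕ K))).coeff d = ∑ i ∈ d.support,
        if d.degree = n then (∏ j ∈ d.support.erase i, (qBinomialSeries q t).coeff (d j)) *
          (if k ≤ d i then newtonCoeff q t k * (qBinomialSeries q t).coeff (d i - k) else 0)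
        else 0 := by
    intro k hk
    rw [map_smul, smul_eq_mul]
    rcases eq_or_ne k 0 with rfl | hk0
    · simp [newtonCoeff_zero]
    rw [coeff_powerSumSeries_mul hk0, Finset.mul_sum]
    refine Finset.sum_congr rfl fun i hi => ?_
    split_ifs with h1 h2 h2
    · have hdeg : (d - Finsupp.single i k).degree = n - k := by
        have := congrArg Finsupp.degree (tsub_add_cancel_of_le (Finsupp.single_le_iff.2 h1))
        rw [map_add, Finsupp.degree_single, h2] at this
        omega
      rw [coeff_g, if_pos hdeg, prod_sub_single (coeff_zero_qBinomialSeries q t) hi]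
      ring
    · rw [coeff_g, if_neg, mul_zero]
      intro hdeg
      have := congrArg Finsupp.degree (tsub_add_cancel_of_le (Finsupp.single_le_iff.2 h1))
      rw [map_add, Finsupp.degree_single, hdeg] at this
      rw [Finset.mem_range] at hk
      omega
    · simp
    · simp
  rw [Finset.sum_congr rfl hterm, Finset.sum_comm]
  split_ifs with h
  · simp only [← Finset.mul_sum]
    have : ∀ i ∈ d.support, (∏ j ∈ d.support.erase i, (qBinomialSeries q t).coeff (d j)) *
        (∑ k ∈ Finset.range (n + 1),
          if k ≤ d i then newtonCoeff q t k * (qBinomialSeries q t).coeff (d i - k) else 0) =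
        (d i : K) * d.prod fun _ k => (qBinomialSeries q t).coeff k := by
      intro i hi
      have hle : d i ≤ n := h ▸ Finsupp.le_degree i d
      rw [← Finset.sum_filter, Finsupp.prod, ← Finset.prod_erase_mul _ _ hi, mul_left_comm,
        natCast_mul_coeff_qBinomialSeries hq]
      congr 2
      ext k
      simp only [Finset.mem_filter, Finset.mem_range]
      omega
    rw [Finset.sum_congr rfl this, ← Finset.sum_mul, ← Nat.cast_sum]
    congr 2
    exact h.symm
  · simp

/-- The polynomial expression of `g_n` in the power sums. -/
def gPoly (q t : K) : ℕ → MvPolynomial ℕ K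
  | 0 => 1
  | n + 1 => MvPolynomial.C ((n + 1 : K)⁻¹) * ∑ k : Fin (n + 1),
      MvPolynomial.C (newtonCoeff q t (k + 1)) * MvPolynomial.X (k + 1 : ℕ) * gPoly q t (n - k)

theorem C_mul_gPoly [CharZero K] (q t : K) (n : ℕ) :
    MvPolynomial.C (n : K) * gPoly q t n = ∑ k ∈ Finset.range (n + 1),
      MvPolynomial.C (newtonCoeff q t k) * MvPolynomial.X k * gPoly q t (n - k) := by
  cases n with
  | zero => simp [newtonCoeff_zero]
  | succ n =>
    have h : (n + 1 : K) ≠ 0 := Nat.cast_add_one_ne_zero n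
    rw [gPoly, ← mul_assoc, ← map_mul, Nat.cast_add_one, mul_inv_cancel₀ h, map_one, one_mul,
      Finset.sum_range_succ', newtonCoeff_zero, map_zero, zero_mul, zero_mul, add_zero,
      Finset.sum_range]
    simp only [Nat.add_sub_add_right]

theorem natCast_C_ne_zero [CharZero K] {σ : Type*} {n : ℕ} (hn : n ≠ 0) :
    (MvPolynomial.C (n : K) : MvPolynomial σ K) ≠ 0 := by
  simpa using hn

/-- With `c_k = newtonCoeff q t k`, this is what `∑ g_n y^n = exp (∑ c_k p_k y^k / k)` predicts for
`∂/∂p_k`. It is proved from the Newton recursion by induction, after multiplying by `n`. -/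
theorem C_mul_pderiv_gPoly [CharZero K] (q t : K) (k n : ℕ) :
    MvPolynomial.C (k : K) * MvPolynomial.pderiv k (gPoly q t n) =
      if k ≤ n then MvPolynomial.C (newtonCoeff q t k) * gPoly q t (n - k) else 0 := by
  induction n using Nat.strong_induction_on with
  | _ n ih =>
  rcases Nat.eq_zero_or_pos n with rfl | hn
  · rw [gPoly, MvPolynomial.pderiv_one, mul_zero]
    split_ifs with h
    · obtain rfl : k = 0 := by omega
      simp [newtonCoeff_zero]
    · rfl
  refine mul_left_cancel₀ (natCast_C_ne_zero (K := K) hn.ne') ?_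
  rw [mul_left_comm, ← MvPolynomial.pderiv_C_mul, C_mul_gPoly, map_sum, Finset.mul_sum]
  have hterm : ∀ j ∈ Finset.range (n + 1), MvPolynomial.C (k : K) * MvPolynomial.pderiv k
      (MvPolynomial.C (newtonCoeff q t j) * MvPolynomial.X j * gPoly q t (n - j)) =
      (if j = k then MvPolynomial.C (k : K) * MvPolynomial.C (newtonCoeff q t k) *
        gPoly q t (n - k) else 0) +
      if k + j ≤ n then MvPolynomial.C (newtonCoeff q t k) *
        (MvPolynomial.C (newtonCoeff q t j) * MvPolynomial.X j * gPoly q t (n - k - j)) else 0 := by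
    intro j hj
    rw [Finset.mem_range] at hj
    -- For `j = 0` the index `n - j` does not drop and the induction hypothesis is unavailable, but
    -- the coefficient is zero.
    rcases eq_or_ne j 0 with rfl | hj0
    · simp only [newtonCoeff_zero, map_zero, zero_mul, mul_zero]
      split_ifs with h1
      · simp [← h1]
      · omega
      · simp
      · simp
    rw [mul_assoc, MvPolynomial.pderiv_C_mul, MvPolynomial.pderiv_mul, mul_add, mul_add]
    congr 1
    · split_ifs with h
      · subst h
        rw [MvPolynomial.pderiv_X_self]
        ring
      · rw [MvPolynomial.pderiv_X_of_ne h]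
        ring
    · have := ih (n - j) (by omega)
      calc _ = MvPolynomial.C (newtonCoeff q t j) * MvPolynomial.X j *
            (MvPolynomial.C (k : K) * MvPolynomial.pderiv k (gPoly q t (n - j))) := by ring
        _ = _ := by
          rw [this]
          have h1 : (k ≤ n - j) = (k + j ≤ n) := by apply propext; omega
          simp only [h1]
          split_ifs
          · rw [Nat.sub_right_comm]
            ring
          · ring
  rw [Finset.sum_congr rfl hterm, Finset.sum_add_distrib, Finset.sum_ite_eq', ← Finset.sum_filter,
    ← Finset.mul_sum]
  by_cases hk : k ≤ n
  · have h1 : (Finset.range (n + 1)).filter (fun j => k + j ≤ n) = Finset.range (n - k + 1) := by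
      ext j
      simp only [Finset.mem_filter, Finset.mem_range]
      omega
    -- The term `j = k` contributes `k`, the recursion for `g_{n-k}` contributes `n - k`, and
    -- together they give the factor `n`.
    rw [h1, ← C_mul_gPoly, if_pos hk, if_pos (Finset.mem_range.2 (by omega)), Nat.cast_sub hk, map_sub]
    ring
  · have h1 : (Finset.range (n + 1)).filter (fun j => k + j ≤ n) = ∅ := by
      ext j
      simp only [Finset.mem_filter, Finset.mem_range, Finset.notMem_empty, iff_false]
      omega
    rw [h1, if_neg hk, if_neg (by rw [Finset.mem_range]; omega)]
    simp

theorem pderiv_prod {R σ ι : Type*} [CommRing R] [DecidableEq ι] (k : σ) (s : Finset ι)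
    (f : ι → MvPolynomial σ R) : MvPolynomial.pderiv k (∏ i ∈ s, f i) =
      ∑ i ∈ s, (∏ j ∈ s.erase i, f j) * MvPolynomial.pderiv k (f i) := by
  induction s using Finset.induction_on with
  | empty => simp
  | insert a s ha ih =>
    rw [Finset.prod_insert ha, MvPolynomial.pderiv_mul, ih, Finset.sum_insert ha,
      Finset.erase_insert ha, Finset.mul_sum, mul_comm]
    congr 1
    refine Finset.sum_congr rfl fun i hi => ?_
    have : i ≠ a := fun h => ha (h ▸ hi)
    rw [Finset.erase_insert_of_ne this.symm, Finset.prod_insert (by simp [ha]), mul_assoc]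

theorem C_mul_pderiv_prod_gPoly [CharZero K] (q t : K) (k : ℕ) (e : ℕ →₀ ℕ) :
    MvPolynomial.C (k : K) * MvPolynomial.pderiv k (e.prod fun _ n => gPoly q t n) =
      MvPolynomial.C (newtonCoeff q t k) * ∑ i ∈ e.support, if k ≤ e i then
        (e - Finsupp.single i k).prod (fun _ n => gPoly q t n) else 0 := by
  rw [Finsupp.prod, pderiv_prod, Finset.mul_sum, Finset.mul_sum]
  refine Finset.sum_congr rfl fun i hi => ?_
  rw [mul_left_comm, C_mul_pderiv_gPoly]
  split_ifs
  · rw [prod_sub_single (by rw [gPoly]) hi]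
    ring
  · ring

theorem isWeightedHomogeneous_gPoly (q t : K) (n : ℕ) :
    MvPolynomial.IsWeightedHomogeneous (id : ℕ → ℕ) (gPoly q t n) n := by
  induction n using Nat.strong_induction_on with
  | _ n ih =>
  cases n with
  | zero => rw [gPoly]; exact MvPolynomial.isWeightedHomogeneous_one _ _
  | succ n =>
    rw [gPoly]
    refine MvPolynomial.IsWeightedHomogeneous.C_mul
      (MvPolynomial.IsWeightedHomogeneous.sum _ _ _ fun k _ => ?_) _
    have h := ((MvPolynomial.isWeightedHomogeneous_X K (id : ℕ → ℕ) (k + 1 : ℕ)).C_mul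
      (newtonCoeff q t (k + 1))).mul (ih (n - k) (by omega))
    have hk := k.2
    have : id (k + 1 : ℕ) + (n - k) = n + 1 := by simp only [id]; omega
    rwa [this] at h

/-- The evaluation of polynomials at the power sums (and at `0` for the variable of index `0`). -/
def evalPowerSum (K : Type*) [Field K] : MvPolynomial ℕ K →ₐ[K] MvPowerSeries ℕ K :=
  MvPolynomial.aeval fun k => if k = 0 then 0 else powerSumSeries K k

theorem g_zero (q t : K) : (g q t 0 : MvPowerSeries ℕ K) = 1 := by
  classical
  ext d
  rw [coeff_g, MvPowerSeries.coeff_one]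
  simp only [Finsupp.degree_eq_zero_iff]
  split_ifs with h
  · simp [h]
  · rfl

theorem evalPowerSum_gPoly [CharZero K] {q : K} (hq : ∀ k, 0 < k → q ^ k ≠ 1) (t : K) (n : ℕ) :
    evalPowerSum K (gPoly q t n) = (g q t n : MvPowerSeries ℕ K) := by
  induction n using Nat.strong_induction_on with
  | _ n ih =>
  rcases Nat.eq_zero_or_pos n with rfl | hn
  · rw [gPoly, map_one, g_zero]
  have hn' : (n : K) ≠ 0 := Nat.cast_ne_zero.2 hn.ne'
  have h := congrArg (evalPowerSum K) (C_mul_gPoly q t n)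
  rw [← MvPolynomial.smul_eq_C_mul, map_smul, map_sum] at h
  refine smul_right_injective _ hn' ?_
  simp only
  rw [h, natCast_smul_g hq]
  refine Finset.sum_congr rfl fun k hk => ?_
  rcases eq_or_ne k 0 with rfl | hk0
  · simp [newtonCoeff_zero]
  rw [mul_assoc, ← MvPolynomial.smul_eq_C_mul, map_smul, map_mul, ih (n - k) (by omega), evalPowerSum,
    MvPolynomial.aeval_X, if_neg hk0]

end Newton

/-! ### Duality of the `g_μ` and the `m_μ` -/

section Duality

variable {K : Type*} [Field K]

/-- `zqt` as a function on multisets. -/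
def zqtMultiset (q t : K) (s : Multiset ℕ) : K :=
  (∏ i ∈ s.toFinset, (i : K) ^ s.count i * ((s.count i).factorial : K)) *
    (s.map fun k => (1 - q ^ k) / (1 - t ^ k)).prod

theorem zqtMultiset_cons (q t : K) (k : ℕ) (s : Multiset ℕ) :
    zqtMultiset q t (k ::ₘ s) =
      zqtMultiset q t s * ((k : K) * (s.count k + 1) * ((1 - q ^ k) / (1 - t ^ k))) := by
  have hk : k ∈ (k ::ₘ s).toFinset := by simp
  have hs : ∏ i ∈ s.toFinset, (i : K) ^ s.count i * ((s.count i).factorial : K) =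
      ∏ i ∈ (k ::ₘ s).toFinset, (i : K) ^ s.count i * ((s.count i).factorial : K) := by
    refine Finset.prod_subset (by simp) fun i _ hi => ?_
    rw [Multiset.mem_toFinset, ← Multiset.count_eq_zero] at hi
    simp [hi]
  rw [zqtMultiset, zqtMultiset, hs, ← Finset.prod_erase_mul _ _ hk, ← Finset.prod_erase_mul _ _ hk,
    Multiset.map_cons, Multiset.prod_cons, Multiset.count_cons_self,
    Finset.prod_congr rfl fun i hi => by rw [Multiset.count_cons_of_ne (Finset.ne_of_mem_erase hi)],
    pow_succ, Nat.factorial_succ]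
  push_cast
  ring

theorem constantCoeff_gPoly (q t : K) {n : ℕ} (hn : n ≠ 0) :
    MvPolynomial.constantCoeff (gPoly q t n) = 0 := by
  obtain ⟨n, rfl⟩ := Nat.exists_eq_succ_of_ne_zero hn
  simp [gPoly]

/-- The left side is the pairing of `g_e` with `p_s`. Multiplication by `p_k` is adjoint to `k (1 -
q^k)/(1 - t^k) ∂/∂p_k`, which sends `g_e` to the sum of the `g` obtained by lowering one exponent by
`k`. Multiplying a series by `p_k` changes its coefficient at `x^e` by the same rule, so induction
on `s` applies. -/
theorem zqtMultiset_mul_coeff [CharZero K] {q t : K} (hq : ∀ k, 0 < k → q ^ k ≠ 1)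
    (ht : ∀ k, 0 < k → t ^ k ≠ 1) (s : Multiset ℕ) (hs : ∀ k ∈ s, 0 < k) (e : ℕ →₀ ℕ) :
    zqtMultiset q t s * (e.prod fun _ n => gPoly q t n).coeff s.toFinsupp =
      (s.map (powerSumSeries K)).prod.coeff e := by
  classical
  induction s using Multiset.induction generalizing e with
  | empty =>
    rw [Multiset.map_zero, Multiset.prod_zero, MvPowerSeries.coeff_one, map_zero,
      ← MvPolynomial.constantCoeff_eq, Finsupp.prod, map_prod]
    have h1 : zqtMultiset q t 0 = 1 := by simp [zqtMultiset]
    rw [h1, one_mul]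
    split_ifs with h
    · simp [h]
    · obtain ⟨i, hi⟩ := Finsupp.support_nonempty_iff.2 h
      exact Finset.prod_eq_zero hi (constantCoeff_gPoly q t (Finsupp.mem_support_iff.1 hi))
  | cons k s ih =>
    have hk := hs k (Multiset.mem_cons_self _ _)
    have hs' : ∀ j ∈ s, 0 < j := fun j hj => hs j (Multiset.mem_cons_of_mem hj)
    have hqk : 1 - q ^ k ≠ 0 := sub_ne_zero.2 (hq k hk).symm
    have htk : 1 - t ^ k ≠ 0 := sub_ne_zero.2 (ht k hk).symm
    have hd := congrArg (MvPolynomial.coeff s.toFinsupp) (C_mul_pderiv_prod_gPoly q t k e)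
    rw [MvPolynomial.coeff_C_mul, MvPolynomial.coeff_C_mul, MvPolynomial.coeff_pderiv,
      MvPolynomial.coeff_sum] at hd
    have hsf : (k ::ₘ s).toFinsupp = s.toFinsupp + Finsupp.single k 1 := by
      rw [← Multiset.singleton_add, map_add, Multiset.toFinsupp_singleton, add_comm]
    rw [Multiset.map_cons, Multiset.prod_cons, coeff_powerSumSeries_mul hk.ne', hsf, zqtMultiset_cons]
    have hih : ∀ i ∈ e.support, (if k ≤ e i then ((s.map (powerSumSeries K)).prod).coeff
        (e - Finsupp.single i k) else 0) = zqtMultiset q t s * MvPolynomial.coeff s.toFinsupp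
          (if k ≤ e i then (e - Finsupp.single i k).prod (fun _ n => gPoly q t n) else 0) := by
      intro i _
      split_ifs
      · rw [ih hs']
      · simp
    rw [Finset.sum_congr rfl hih, ← Finset.mul_sum]
    rw [Multiset.toFinsupp_apply] at hd
    have hc : newtonCoeff q t k ≠ 0 := div_ne_zero htk hqk
    refine mul_left_cancel₀ hc ?_
    rw [mul_left_comm _ (zqtMultiset q t s), ← hd, newtonCoeff]
    field_simp

/-- Monomials of weight `n` without the variable `0` correspond to partitions of `n`; those
containing it are killed because `evalPowerSum` sends that variable to `0`. -/
theorem evalPowerSum_eq_sum {n : ℕ} {Φ : MvPolynomial ℕ K}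
    (hΦ : MvPolynomial.IsWeightedHomogeneous (id : ℕ → ℕ) Φ n) :
    evalPowerSum K Φ = ((∑ p : n.Partition, Φ.coeff p.parts.toFinsupp • powerSumProd K p :
      SymFun K n) : MvPowerSeries ℕ K) := by
  classical
  rw [Submodule.coe_sum, evalPowerSum, MvPolynomial.aeval_def, MvPolynomial.eval₂_eq]
  have hne0 : ∀ s : ℕ →₀ ℕ, algebraMap K (MvPowerSeries ℕ K) (Φ.coeff s) *
      ∏ i ∈ s.support, (if i = 0 then 0 else powerSumSeries K i) ^ s i ≠ 0 → s 0 = 0 := by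
    intro s h
    by_contra h0
    refine h ?_
    rw [Finset.prod_eq_zero (Finsupp.mem_support_iff.2 h0), mul_zero]
    rw [if_pos rfl, zero_pow h0]
  have hparts : ∀ p : n.Partition, Finsupp.toMultiset p.parts.toFinsupp = p.parts := fun p =>
    Multiset.toFinsupp_toMultiset _
  have hterm : ∀ (p : n.Partition) (s : ℕ →₀ ℕ), Finsupp.toMultiset s = p.parts →
      algebraMap K (MvPowerSeries ℕ K) (Φ.coeff s) *
        ∏ i ∈ s.support, (if i = 0 then 0 else powerSumSeries K i) ^ s i =
      ((Φ.coeff p.parts.toFinsupp • powerSumProd K p : SymFun K n) : MvPowerSeries ℕ K) := by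
    intro p s hs
    have hp : (powerSumProd K p : MvPowerSeries ℕ K) = (p.parts.map (powerSumSeries K)).prod := rfl
    rw [Submodule.coe_smul, Algebra.smul_def, hp, Finset.prod_multiset_map_count, ← hs,
      Finsupp.toMultiset_toFinsupp, Finsupp.toFinset_toMultiset]
    congr 1
    refine Finset.prod_congr rfl fun i hi => ?_
    have : i ∈ p.parts := by rwa [← hs, Finsupp.mem_toMultiset]
    rw [if_neg (p.parts_pos this).ne', Finsupp.count_toMultiset]
  -- Only nonzero terms are matched: monomials involving the variable `0` give no partition, and
  -- partitions with zero coefficient give no monomial of `Φ`.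
  refine Finset.sum_bij_ne_zero (fun s hs hne => ⟨Finsupp.toMultiset s, ?_, ?_⟩) ?_ ?_ ?_ ?_
  · intro i hi
    rw [Finsupp.mem_toMultiset, Finsupp.mem_support_iff] at hi
    rcases Nat.eq_zero_or_pos i with rfl | h
    · exact absurd (hne0 s hne) hi
    · exact h
  · have h := hΦ (MvPolynomial.mem_support_iff.1 hs)
    rw [← h, Finsupp.weight_apply, Finsupp.toMultiset_apply, Finsupp.sum, Finsupp.sum,
      Multiset.sum_sum]
    simp [Multiset.sum_nsmul]
  · intro s hs hne
    exact Finset.mem_univ _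
  · intro s hs hne s' hs' hne' h
    exact Multiset.toFinsupp.symm.injective (congrArg Nat.Partition.parts h)
  · intro p _ hp
    have h := hterm p _ (hparts p)
    refine ⟨p.parts.toFinsupp, ?_, ?_, ?_⟩
    · rw [MvPolynomial.mem_support_iff]
      intro h0
      apply hp
      rw [h0, zero_smul]
      rfl
    · rw [h]
      exact hp
    · exact Nat.Partition.ext (hparts p)
  · intro s hs hne
    exact hterm _ s rfl

/-- Both sides are linear in `f`, so it suffices to take `f` a product of power sums, where this is
`zqtMultiset_mul_coeff`. -/
theorem scalarProduct_gProd [CharZero K] {q t : K} (hq : ∀ k, 0 < k → q ^ k ≠ 1)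
    (ht : ∀ k, 0 < k → t ^ k ≠ 1) {n : ℕ} (p : n.Partition) {e : ℕ →₀ ℕ} (he : expType e = p.parts)
    (f : SymFun K n) : scalarProduct q t n (gProd q t p) f = (f : MvPowerSeries ℕ K).coeff e := by
  classical
  set Φ := e.prod fun _ k => gPoly q t k with hΦ
  have hhom : MvPolynomial.IsWeightedHomogeneous (id : ℕ → ℕ) Φ n := by
    have h := MvPolynomial.IsWeightedHomogeneous.prod e.support (fun i => gPoly q t (e i)) e
      (fun i _ => isWeightedHomogeneous_gPoly q t (e i))
    have h2 : ∑ i ∈ e.support, e i = n := degree_eq_of_expType he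
    rwa [h2] at h
  have hg : gProd q t p = ∑ r : n.Partition, Φ.coeff r.parts.toFinsupp • powerSumProd K r := by
    apply Subtype.ext
    rw [← evalPowerSum_eq_sum hhom, hΦ, Finsupp.prod, map_prod]
    have : (gProd q t p : MvPowerSeries ℕ K) =
        (p.parts.map fun k => (g q t k : MvPowerSeries ℕ K)).prod := rfl
    rw [this, ← he, expType, Multiset.map_map]
    exact Finset.prod_congr rfl fun i _ => (evalPowerSum_gPoly hq t (e i)).symm
  have hp : ∀ r : n.Partition, scalarProduct q t n (gProd q t p) (powerSumProd K r) =
      (powerSumProd K r : MvPowerSeries ℕ K).coeff e := by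
    intro r
    rw [hg, map_sum, LinearMap.sum_apply, Finset.sum_eq_single r]
    · rw [map_smul, LinearMap.smul_apply, scalarProduct_powerSumProd, if_pos rfl, smul_eq_mul, mul_comm]
      exact zqtMultiset_mul_coeff hq ht r.parts (fun k hk => r.parts_pos hk) e
    · intro r' _ hr
      rw [map_smul, LinearMap.smul_apply, scalarProduct_powerSumProd, if_neg hr, smul_zero]
    · simp
  rw [← (powerSumBasis K n).sum_repr f]
  simp only [powerSumBasis_apply, map_sum, map_smul, hp, Submodule.coe_sum, Submodule.coe_smul]

theorem scalarProduct_gProd_mono [CharZero K] {q t : K} (hq : ∀ k, 0 < k → q ^ k ≠ 1)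
    (ht : ∀ k, 0 < k → t ^ k ≠ 1) {n : ℕ} (p r : n.Partition) :
    scalarProduct q t n (gProd q t p) (mono K r) = if p = r then 1 else 0 := by
  obtain ⟨e, he⟩ := exists_expType_eq p
  rw [scalarProduct_gProd hq ht p he, coeff_mono, he]
  simp only [Nat.Partition.ext_iff]

end Duality

/-! ### Nonvanishing of norms over `ℚ(q,t)` by a real specialization -/

section Positivity

theorem qq_pow_ne_one (k : ℕ) (hk : 0 < k) : qq ^ k ≠ 1 := by
  intro h
  rw [qq, ← map_pow, ← map_one (algebraMap (MvPolynomial (Fin 2) ℚ) Qqt)] at h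
  have h1 := congrArg (MvPolynomial.eval fun _ => (0 : ℚ)) (IsFractionRing.injective _ _ h)
  simp [hk.ne'] at h1

theorem tt_pow_ne_one (k : ℕ) (hk : 0 < k) : tt ^ k ≠ 1 := by
  intro h
  rw [tt, ← map_pow, ← map_one (algebraMap (MvPolynomial (Fin 2) ℚ) Qqt)] at h
  have h1 := congrArg (MvPolynomial.eval fun _ => (0 : ℚ)) (IsFractionRing.injective _ _ h)
  simp [hk.ne'] at h1

theorem qq_ne_zero : qq ≠ 0 := fun h =>
  MvPolynomial.X_ne_zero (R := ℚ) (0 : Fin 2) (IsFractionRing.injective (MvPolynomial (Fin 2) ℚ) Qqt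
    (h.trans (map_zero _).symm))

theorem tt_ne_zero : tt ≠ 0 := fun h =>
  MvPolynomial.X_ne_zero (R := ℚ) (1 : Fin 2) (IsFractionRing.injective (MvPolynomial (Fin 2) ℚ) Qqt
    (h.trans (map_zero _).symm))

/-- Only countably many reals are algebraic over a countable ring, while the interval has the
cardinality of the continuum. -/
theorem exists_transcendental_Ioo (R : Type) [CommRing R] [IsDomain R] [Countable R] [Algebra R ℝ]
    [Module.IsTorsionFree R ℝ] : ∃ a ∈ Set.Ioo (0 : ℝ) 1, Transcendental R a := by
  by_contra! h
  have h1 : Set.Ioo (0 : ℝ) 1 ⊆ {x : ℝ | IsAlgebraic R x} := fun x hx => by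
    by_contra hx'
    exact h x hx hx'
  have h2 := (Algebraic.countable R ℝ).mono h1
  rw [← Cardinal.le_aleph0_iff_set_countable, Cardinal.mk_Ioo_real one_pos] at h2
  exact absurd h2 (not_le.2 Cardinal.aleph0_lt_continuum)

theorem exists_algebraicIndependent_Ioo :
    ∃ x : Fin 2 → ℝ, (∀ i, x i ∈ Set.Ioo (0 : ℝ) 1) ∧ AlgebraicIndependent ℚ x := by
  obtain ⟨a, ha, ha'⟩ := exists_transcendental_Ioo ℚ
  have hcount : Countable (Algebra.adjoin ℚ (Set.range fun _ : Unit => a)) := by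
    rw [← Cardinal.mk_le_aleph0_iff]
    refine (Algebra.cardinalMk_adjoin_le ℚ _).trans ?_
    simp
  -- Choosing `b` transcendental over `ℚ[a]`, which is still countable, makes the pair `a, b`
  -- algebraically independent.
  obtain ⟨b, hb, hb'⟩ := exists_transcendental_Ioo (Algebra.adjoin ℚ (Set.range fun _ : Unit => a))
  have h1 : AlgebraicIndependent ℚ fun _ : Unit => a := by
    rwa [algebraicIndependent_unique_type_iff]
  have h2 := (h1.option_iff_transcendental b).2 hb'
  have hinj : Function.Injective (![some (), none] : Fin 2 → Option Unit) := by decide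
  refine ⟨_, ?_, h2.comp _ hinj⟩
  intro i
  fin_cases i
  · exact ha
  · exact hb

theorem exists_realEmbedding : ∃ φ : Qqt →+* ℝ, φ qq ∈ Set.Ioo (0 : ℝ) 1 ∧ φ tt ∈ Set.Ioo (0 : ℝ) 1 := by
  obtain ⟨x, hx, hind⟩ := exists_algebraicIndependent_Ioo
  have hinj : Function.Injective (MvPolynomial.aeval x : MvPolynomial (Fin 2) ℚ →ₐ[ℚ] ℝ).toRingHom := hind
  refine ⟨IsFractionRing.lift hinj, ?_, ?_⟩
  · rw [qq, IsFractionRing.lift_algebraMap]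
    simpa using hx 0
  · rw [tt, IsFractionRing.lift_algebraMap]
    simpa using hx 1

theorem scalarProduct_eq_sum {K : Type*} [Field K] [CharZero K] (q t : K) {n : ℕ} (f h : SymFun K n) :
    scalarProduct q t n f h = ∑ p, zqt q t p *
      ((powerSumBasis K n).repr f p * (powerSumBasis K n).repr h p) := by
  classical
  rw [scalarProduct, Matrix.toBilin_apply]
  refine Finset.sum_congr rfl fun p _ => ?_
  rw [Finset.sum_eq_single p]
  · rw [Matrix.diagonal_apply_eq]; ring
  · intro r _ hr
    rw [Matrix.diagonal_apply_ne _ hr.symm]; ring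
  · simp

theorem scalarProduct_comm {K : Type*} [Field K] [CharZero K] (q t : K) {n : ℕ} (f h : SymFun K n) :
    scalarProduct q t n f h = scalarProduct q t n h f := by
  rw [scalarProduct_eq_sum, scalarProduct_eq_sum]
  simp only [mul_comm]

theorem zqt_pos {q t : ℝ} (hq : q ∈ Set.Ioo (0 : ℝ) 1) (ht : t ∈ Set.Ioo (0 : ℝ) 1) {n : ℕ}
    (p : n.Partition) : 0 < zqt q t p := by
  refine mul_pos (Finset.prod_pos fun i hi => ?_) (Multiset.prod_pos fun x hx => ?_)
  · have := p.parts_pos (Multiset.mem_toFinset.1 hi)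
    positivity
  · obtain ⟨k, hk, rfl⟩ := Multiset.mem_map.1 hx
    have hk' := (p.parts_pos hk).ne'
    exact div_pos (sub_pos.2 (pow_lt_one₀ hq.1.le hq.2 hk')) (sub_pos.2 (pow_lt_one₀ ht.1.le ht.2 hk'))

theorem map_zqt {K K' : Type*} [Field K] [Field K'] (φ : K →+* K') (q t : K) {n : ℕ}
    (p : n.Partition) : φ (zqt q t p) = zqt (φ q) (φ t) p := by
  rw [zqt, zqt, map_mul, map_prod, map_multiset_prod, Multiset.map_map]
  simp

/-- In the power sum basis the form is diagonal, and its entries become positive reals under the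
embedding; a vanishing sum of nonnegative terms forces every coordinate to vanish. The Gram-Schmidt
divisions are therefore by nonzero norms. -/
theorem scalarProduct_self_ne_zero {n : ℕ} {f : SymFun Qqt n} (hf : f ≠ 0) :
    scalarProduct qq tt n f f ≠ 0 := by
  obtain ⟨φ, hq, ht⟩ := exists_realEmbedding
  intro h
  have h1 := congrArg φ h
  rw [scalarProduct_eq_sum, map_sum, map_zero] at h1
  simp only [map_mul, map_zqt] at h1
  have hnonneg : ∀ p ∈ (Finset.univ : Finset n.Partition), 0 ≤ zqt (φ qq) (φ tt) p *
      (φ ((powerSumBasis Qqt n).repr f p) * φ ((powerSumBasis Qqt n).repr f p)) := fun p _ =>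
    mul_nonneg (zqt_pos hq ht p).le (mul_self_nonneg _)
  rw [Finset.sum_eq_zero_iff_of_nonneg hnonneg] at h1
  refine hf ((powerSumBasis Qqt n).ext_elem fun p => ?_)
  have h2 := mul_self_eq_zero.1
    ((mul_eq_zero.1 (h1 p (Finset.mem_univ p))).resolve_left (zqt_pos hq ht p).ne')
  rw [(map_eq_zero φ).1 h2, map_zero, Finsupp.zero_apply]

end Positivity

/-! ### Orthogonality of the `P_λ` and elimination of the Macdonald basis from the kernel -/

section Orthogonality

variable {K : Type*} [Field K] [CharZero K] {q t : K} {n : ℕ}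

theorem LexLT.trans {p r s : n.Partition} (h : LexLT p r) (h' : LexLT r s) : LexLT p s :=
  lt_trans (α := List ℕ) h h'

theorem lexLT_or_lexLT {p r : n.Partition} (h : p ≠ r) : LexLT p r ∨ LexLT r p :=
  lt_or_gt_of_ne (α := List ℕ) fun h' => h (partList_injective h')

theorem macdonaldP_sub_mono_mem (q t : K) (p : n.Partition) :
    macdonaldP q t n p - mono K p ∈ Submodule.span K (mono K '' {r | LexLT r p}) := by
  induction p using (lexLT_wf n).induction with
  | _ p ih =>
  rw [macdonaldP_eq, sub_sub_cancel_left, Submodule.neg_mem_iff]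
  refine Submodule.sum_mem _ fun r hr => Submodule.smul_mem _ _ ?_
  have hr' : LexLT r p := (Finset.mem_filter.1 hr).2
  have h1 := Submodule.span_mono (Set.image_mono fun s (hs : LexLT s r) => hs.trans hr') (ih r hr')
  have h2 := Submodule.add_mem _ h1 (Submodule.subset_span ⟨r, hr', rfl⟩)
  rwa [sub_add_cancel] at h2

/-- Lexicographic unitriangularity: `m_p` is not in the span of the lexicographically smaller `m_r`.
-/
theorem macdonaldP_ne_zero (q t : K) (p : n.Partition) : macdonaldP q t n p ≠ 0 := by
  intro h0
  have h1 := macdonaldP_sub_mono_mem q t p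
  rw [h0, zero_sub, Submodule.neg_mem_iff] at h1
  have hm : ⇑(monoBasis K n) = mono K (n := n) := funext monoBasis_apply
  rw [← hm, Module.Basis.self_mem_span_image] at h1
  exact lt_irrefl (partList p) h1

theorem mem_span_macdonaldP (q t : K) (f : SymFun K n) :
    f ∈ Submodule.span K (Set.range (macdonaldP q t n)) := by
  rw [← (monoBasis K n).sum_repr f]
  refine Submodule.sum_mem _ fun p _ => Submodule.smul_mem _ _ ?_
  rw [monoBasis_apply, ← sub_add_cancel (mono K p) (∑ r ∈ Finset.univ.filter fun r => LexLT r p,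
    (scalarProduct q t n (mono K p) (macdonaldP q t n r) /
      scalarProduct q t n (macdonaldP q t n r) (macdonaldP q t n r)) • macdonaldP q t n r),
    ← macdonaldP_eq]
  exact Submodule.add_mem _ (Submodule.subset_span ⟨p, rfl⟩)
    (Submodule.sum_mem _ fun r _ => Submodule.smul_mem _ _ (Submodule.subset_span ⟨r, rfl⟩))

theorem macdonaldP_orthogonal
    (hanis : ∀ f : SymFun K n, f ≠ 0 → scalarProduct q t n f f ≠ 0) {p r : n.Partition} (h : p ≠ r) :
    scalarProduct q t n (macdonaldP q t n p) (macdonaldP q t n r) = 0 := by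
  have key : ∀ p r : n.Partition, LexLT r p →
      scalarProduct q t n (macdonaldP q t n p) (macdonaldP q t n r) = 0 := by
    intro p
    induction p using (lexLT_wf n).induction with
    | _ p ih =>
    intro r hr
    rw [macdonaldP_eq q t n p, map_sub, LinearMap.sub_apply, map_sum, LinearMap.sum_apply,
      Finset.sum_eq_single r]
    · rw [map_smul, LinearMap.smul_apply, smul_eq_mul,
        div_mul_cancel₀ _ (hanis _ (macdonaldP_ne_zero q t r)), sub_self]
    · intro s hs hsr
      rw [map_smul, LinearMap.smul_apply]
      -- Among the terms subtracted from `m_p` only the one with index `r` pairs nontrivially with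
      -- `P_r`. The others vanish by induction on the larger of `r` and `s`, which is below `p`
      -- either way.
      rcases lexLT_or_lexLT hsr with h1 | h1
      · rw [scalarProduct_comm q t (macdonaldP q t n s) (macdonaldP q t n r), ih r hr s h1, smul_zero]
      · rw [ih s (Finset.mem_filter.1 hs).2 r h1, smul_zero]
    · intro h1
      exact absurd (Finset.mem_filter.2 ⟨Finset.mem_univ r, hr⟩) h1
  rcases lexLT_or_lexLT h with h1 | h1
  · rw [scalarProduct_comm]
    exact key r p h1
  · exact key p r h1

theorem eq_zero_of_scalarProduct_eq_zero
    (hanis : ∀ f : SymFun K n, f ≠ 0 → scalarProduct q t n f f ≠ 0) {ι : Type*}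
    {v : ι → SymFun K n} (hv : ∀ f, f ∈ Submodule.span K (Set.range v)) {f : SymFun K n}
    (h : ∀ i, scalarProduct q t n f (v i) = 0) : f = 0 := by
  by_contra hf
  refine hanis f hf ?_
  have h1 : Submodule.span K (Set.range v) ≤ LinearMap.ker (scalarProduct q t n f) :=
    Submodule.span_le.2 (by rintro _ ⟨i, rfl⟩; exact h i)
  exact h1 (hv f)

/-- Expansion along an orthogonal basis, tested against each `P_r`. -/
theorem sum_scalarProduct_smul_macdonaldQ
    (hanis : ∀ f : SymFun K n, f ≠ 0 → scalarProduct q t n f f ≠ 0) (f : SymFun K n) :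
    ∑ p, scalarProduct q t n (macdonaldP q t n p) f • macdonaldQ q t n p = f := by
  rw [← sub_eq_zero]
  refine eq_zero_of_scalarProduct_eq_zero hanis (mem_span_macdonaldP q t) fun r => ?_
  rw [map_sub, LinearMap.sub_apply, map_sum, LinearMap.sum_apply, Finset.sum_eq_single r]
  · rw [macdonaldQ, macdonaldB, smul_smul, map_smul, LinearMap.smul_apply, smul_eq_mul, mul_assoc,
      inv_mul_cancel₀ (hanis _ (macdonaldP_ne_zero q t r)), mul_one, scalarProduct_comm, sub_self]
  · intro s _ hs
    rw [macdonaldQ, smul_smul, map_smul, LinearMap.smul_apply, macdonaldP_orthogonal hanis hs, smul_zero]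
  · simp

theorem gToP_eq (hq : ∀ k, 0 < k → q ^ k ≠ 1) (ht : ∀ k, 0 < k → t ^ k ≠ 1)
    (hanis : ∀ f : SymFun K n, f ≠ 0 → scalarProduct q t n f f ≠ 0) (p r : n.Partition) :
    gToP q t p r = scalarProduct q t n (macdonaldP q t n p) (mono K r) := by
  classical
  -- Pairing with `m_r` reads off the coefficient of `g_r`. This yields both the existence of an
  -- expansion and its uniqueness, so the choice made in `gToP` is immaterial.
  have hpair : ∀ (c : n.Partition → K) (r : n.Partition),
      scalarProduct q t n (∑ s, c s • gProd q t s) (mono K r) = c r := by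
    intro c r
    rw [map_sum, LinearMap.sum_apply, Finset.sum_eq_single r]
    · rw [map_smul, LinearMap.smul_apply, scalarProduct_gProd_mono hq ht, if_pos rfl, smul_eq_mul,
        mul_one]
    · intro s _ hs
      rw [map_smul, LinearMap.smul_apply, scalarProduct_gProd_mono hq ht, if_neg hs, smul_zero]
    · simp
  have hex : ∃ c : n.Partition → K, macdonaldP q t n p = ∑ r, c r • gProd q t r := by
    refine ⟨fun r => scalarProduct q t n (macdonaldP q t n p) (mono K r), sub_eq_zero.1 ?_⟩
    refine eq_zero_of_scalarProduct_eq_zero (v := mono K) hanis (fun f => ?_) fun r => ?_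
    · have hm : ⇑(monoBasis K n) = mono K (n := n) := funext monoBasis_apply
      rw [← hm, (monoBasis K n).span_eq]
      exact Submodule.mem_top
    · rw [map_sub, LinearMap.sub_apply, hpair, sub_self]
  rw [gToP, dif_pos hex, ← hpair hex.choose r, ← hex.choose_spec]

open TensorProduct in
-- Summing over `λ` first, `∑ c_{λr} Q_λ = m_r`; all trace of the Macdonald functions disappears.
theorem kernel_eq_sum_mono (hq : ∀ k, 0 < k → q ^ k ≠ 1) (ht : ∀ k, 0 < k → t ^ k ≠ 1)
    (hanis : ∀ f : SymFun K n, f ≠ 0 → scalarProduct q t n f f ≠ 0) :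
    kernel q t n = ∑ r : n.Partition, mono K r ⊗ₜ[K]
      (algebraMap K (RatFn K (Fin n)) ((-1) ^ n / ((1 - q) ^ n * n.factorial)) *
        (algebraMap K (RatFn K (Fin n))
          (n.factorial / (r.parts.map fun k => (k.factorial : K)).prod) * epsProd q t t r)) := by
  have hF : ∀ p : n.Partition, F q t p = ∑ r : n.Partition, gToP q t p r •
      (algebraMap K (RatFn K (Fin n)) ((-1) ^ n / ((1 - q) ^ n * n.factorial)) *
        (algebraMap K (RatFn K (Fin n))
          (n.factorial / (r.parts.map fun k => (k.factorial : K)).prod) * epsProd q t t r)) := by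
    intro p
    rw [F, Finset.mul_sum]
    refine Finset.sum_congr rfl fun r _ => ?_
    rw [Algebra.smul_def, map_mul]
    ring
  simp only [kernel, hF, TensorProduct.tmul_sum, TensorProduct.tmul_smul]
  rw [Finset.sum_comm]
  refine Finset.sum_congr rfl fun r _ => ?_
  simp only [TensorProduct.smul_tmul']
  rw [← TensorProduct.sum_tmul]
  simp only [gToP_eq hq ht hanis, sum_scalarProduct_smul_macdonaldQ hanis]

end Orthogonality

/-! ### Coefficients of monomials in finitely many variables -/

section Coefficients

variable {K : Type*} [Field K]

theorem coeff_restrict (m n : ℕ) (f : SymFun K n) (d : Fin m →₀ ℕ) :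
    (restrict K m n f).coeff d =
      (f : MvPowerSeries ℕ K).coeff (d.embDomain Fin.valEmbedding) := by
  rw [← MvPolynomial.coeff_coe, coe_restrict, MvPowerSeries.coeff_killCompl]

theorem expType_embDomain_fin {m : ℕ} (d : Fin m →₀ ℕ) :
    expType (d.embDomain Fin.valEmbedding) = (((List.ofFn d).filter (· ≠ 0) : List ℕ) : Multiset ℕ) := by
  have h1 : expType (d.embDomain Fin.valEmbedding) = d.support.val.map d := by
    rw [expType, Finsupp.support_embDomain, Finset.map_val, Multiset.map_map]
    exact Multiset.map_congr rfl fun i _ => Finsupp.embDomain_apply_self Fin.valEmbedding d i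
  have h2 : d.support = Finset.univ.filter fun j => d j ≠ 0 := by ext; simp
  rw [h1, h2, Finset.filter_val, ← Multiset.filter_coe, ← Fin.univ_val_map, Multiset.filter_map]
  rfl

theorem degree_embDomain_fin {m : ℕ} (d : Fin m →₀ ℕ) :
    (d.embDomain Fin.valEmbedding).degree = d.degree := by
  rw [Finsupp.embDomain_eq_mapDomain, Finsupp.degree_mapDomain]

theorem prod_X_eq_monomial {R σ ι : Type*} [CommSemiring R] (s : Finset ι) (i : ι → σ) :
    ∏ α ∈ s, MvPolynomial.X (R := R) (i α) =
      MvPolynomial.monomial (∑ α ∈ s, Finsupp.single (i α) 1) 1 := by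
  rw [MvPolynomial.monomial_sum_one]
  rfl

theorem sum_single_eq_iff {m n : ℕ} (i : Fin n → Fin m) (d : Fin m →₀ ℕ) (c : Fin n → Fin m) :
    ∑ α, Finsupp.single (i α) 1 = d ↔ i ∈ colorings d Finset.univ 0 c := by
  simp only [mem_colorings, Finset.mem_univ, not_true_eq_false, false_imp_iff, implies_true,
    Nat.zero_le, true_and, true_imp_iff]
  rw [DFunLike.ext_iff]
  refine forall_congr' fun j => ?_
  rw [Finsupp.finsetSum_apply, Finset.card_filter]
  simp only [Finsupp.single_apply]

/-- Supplies the base map that `colorings` asks for; its values do not matter when the active set is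
everything, but a map has to exist, also when there are no colours. -/
theorem exists_coloring {m n : ℕ} {d : Fin m →₀ ℕ} (hd : d.degree = n) : Nonempty (Fin n → Fin m) := by
  rcases Nat.eq_zero_or_pos m with rfl | hm
  · obtain rfl : n = 0 := by rw [← hd, Subsingleton.elim d 0, map_zero]
    exact ⟨Fin.elim0⟩
  · exact ⟨fun _ => ⟨0, hm⟩⟩

theorem coeff_sum_colorings {L : Type*} [Field L] {q t : L} (hq : q ≠ 0) (ht : t ≠ 0) {m n : ℕ}
    (z : Fin n → L) (d : Fin m →₀ ℕ) :
    (∑ i : Fin n → Fin m, (∏ α : Fin n, MvPolynomial.X (i α)) *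
      MvPolynomial.C (∏ α : Fin n, ∏ β ∈ Finset.Ioi α, gamma q t (i α) (i β) (z α) (z β))).coeff d =
      if d.degree = n then listSum q t z Finset.univ (List.ofFn d) else 0 := by
  classical
  rw [MvPolynomial.coeff_sum]
  have hterm : ∀ i : Fin n → Fin m, ((∏ α : Fin n, MvPolynomial.X (i α)) *
      MvPolynomial.C (∏ α : Fin n, ∏ β ∈ Finset.Ioi α, gamma q t (i α) (i β) (z α) (z β))).coeff d =
      if ∑ α, Finsupp.single (i α) 1 = d then
        pairProd (fun α β => gamma q t (i α) (i β) (z α) (z β)) Finset.univ else 0 := by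
    intro i
    have : pairProd (fun α β => gamma q t (i α) (i β) (z α) (z β)) Finset.univ =
        ∏ α : Fin n, ∏ β ∈ Finset.Ioi α, gamma q t (i α) (i β) (z α) (z β) := by
      refine Finset.prod_congr rfl fun α _ => ?_
      rw [← Finset.prod_filter]
      refine Finset.prod_congr ?_ fun _ _ => rfl
      ext; simp
    rw [prod_X_eq_monomial, mul_comm, MvPolynomial.coeff_C_mul, MvPolynomial.coeff_monomial, this]
    split_ifs <;> simp
  rw [Finset.sum_congr rfl fun i _ => hterm i]
  split_ifs with hd
  · obtain ⟨c⟩ := exists_coloring hd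
    simp only [sum_single_eq_iff _ d c]
    rw [← Finset.sum_filter, Finset.filter_univ_mem, sum_colorings hq ht z d 0 (Nat.zero_le _), List.drop_zero]
  · refine Finset.sum_eq_zero fun i _ => if_neg fun h => hd ?_
    rw [← h, map_sum]
    simp

end Coefficients

/-! ### Comparison of the two sides -/

section Main

variable {K : Type*} [Field K] [CharZero K] {q t : K}

theorem epsProd_eq (ht : t ≠ 0) {n : ℕ} (r : n.Partition) :
    algebraMap K (RatFn K (Fin n)) (n.factorial / (r.parts.map fun k => (k.factorial : K)).prod) *
        epsProd q t t r =
      listSum (algebraMap K (RatFn K (Fin n)) q) (algebraMap K (RatFn K (Fin n)) t) (zvar K)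
        Finset.univ (partList r) := by
  have := charZero_ratFn K (Fin n)
  have h1 : (r.parts.map fun k => (k.factorial : K)).prod =
      (((partList r).map Nat.factorial).prod : ℕ) := by
    rw [← partList_coe, Multiset.map_coe, Multiset.prod_coe, Nat.cast_list_prod, List.map_map]
    rfl
  have h2 : (((partList r).map Nat.factorial).prod : RatFn K (Fin n)) ≠ 0 := by
    rw [Nat.cast_ne_zero]
    refine List.prod_ne_zero fun h => ?_
    obtain ⟨k, _, hk⟩ := List.mem_map.1 h
    exact Nat.factorial_ne_zero k hk
  have h3 : ((partList r).sum.factorial : RatFn K (Fin n)) = (n.factorial : RatFn K (Fin n)) := by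
    rw [partList_sum]
  have h4 : (n.factorial : RatFn K (Fin n)) ≠ 0 := Nat.cast_ne_zero.2 (Nat.factorial_ne_zero _)
  rw [epsProd, renameRat_epsList ht, h1, Finset.map_univ_equiv, h3, map_div₀, map_natCast, map_natCast]
  field_simp

theorem restrictX_kernel (hq0 : q ≠ 0) (ht0 : t ≠ 0) (hq : ∀ k, 0 < k → q ^ k ≠ 1)
    (ht : ∀ k, 0 < k → t ^ k ≠ 1) {n : ℕ}
    (hanis : ∀ f : SymFun K n, f ≠ 0 → scalarProduct q t n f f ≠ 0) (m : ℕ) :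
    restrictX K m n (kernel q t n) =
      MvPolynomial.C (algebraMap K (RatFn K (Fin n))
          ((-1) ^ n / ((1 - q) ^ n * (n.factorial : K)))) *
        ∑ i : Fin n → Fin m, (∏ α : Fin n, MvPolynomial.X (i α)) *
          MvPolynomial.C (∏ α : Fin n, ∏ β ∈ Finset.Ioi α,
            gamma (algebraMap K (RatFn K (Fin n)) q) (algebraMap K (RatFn K (Fin n)) t)
              (i α) (i β) (zvar K α) (zvar K β)) := by
  have hq' : algebraMap K (RatFn K (Fin n)) q ≠ 0 := by simpa using hq0
  have ht' : algebraMap K (RatFn K (Fin n)) t ≠ 0 := by simpa using ht0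
  have ht2 : algebraMap K (RatFn K (Fin n)) t ^ 2 ≠ 1 := by
    rw [← map_pow, ← map_one (algebraMap K (RatFn K (Fin n)))]
    exact fun h => ht 2 two_pos ((algebraMap K (RatFn K (Fin n))).injective h)
  have hz : Generic (algebraMap K (RatFn K (Fin n)) t)⁻¹ (zvar K (σ := Fin n)) := by
    rw [← map_inv₀]
    exact generic_zvar t⁻¹
  ext d
  rw [MvPolynomial.coeff_C_mul, coeff_sum_colorings hq' ht', kernel_eq_sum_mono hq ht hanis, map_sum,
    MvPolynomial.coeff_sum]
  have hterm : ∀ r : n.Partition, (restrictX K m n (TensorProduct.tmul K (mono K r)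
      (algebraMap K (RatFn K (Fin n)) ((-1) ^ n / ((1 - q) ^ n * n.factorial)) *
        (algebraMap K (RatFn K (Fin n))
          (n.factorial / (r.parts.map fun k => (k.factorial : K)).prod) * epsProd q t t r)))).coeff d =
      if expType (d.embDomain Fin.valEmbedding) = r.parts then
        algebraMap K (RatFn K (Fin n)) ((-1) ^ n / ((1 - q) ^ n * n.factorial)) *
          listSum (algebraMap K (RatFn K (Fin n)) q) (algebraMap K (RatFn K (Fin n)) t) (zvar K)
            Finset.univ (partList r) else 0 := by
    intro r
    rw [restrictX, TensorProduct.lift.tmul, LinearMap.mk₂_apply, MvPolynomial.coeff_smul,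
      MvPolynomial.coeff_map, coeff_restrict, coeff_mono, epsProd_eq ht0]
    split_ifs <;> simp
  rw [Finset.sum_congr rfl fun r _ => hterm r]
  split_ifs with hd
  · let p : n.Partition := ⟨expType (d.embDomain Fin.valEmbedding), expType_pos, by
      rw [expType_sum, degree_embDomain_fin, hd]⟩
    -- Only the partition formed by the nonzero exponents of `d` contributes. Its decreasing parts
    -- and the exponent list of `d` differ by zeros and a reordering, neither of which affects
    -- `listSum`.
    rw [Finset.sum_eq_single p]
    · rw [if_pos rfl]
      congr 1
      rw [← listSum_filter _ _ _ _ (List.ofFn d)]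
      refine listSum_perm hq' ht' ht2 hz ?_ _
      rw [← Multiset.coe_eq_coe, partList_coe, ← expType_embDomain_fin]
    · intro r _ hr
      rw [if_neg fun h => hr (Nat.Partition.ext h.symm)]
    · simp
  · rw [mul_zero]
    refine Finset.sum_eq_zero fun r _ => if_neg fun h => hd ?_
    rw [← degree_embDomain_fin]
    exact degree_eq_of_expType h

end Main

end MacdonaldKernel

end

theorem mainTheorem4 (m n : ℕ) :
    restrictX Qqt m n (kernel qq tt n) =
      MvPolynomial.C (algebraMap Qqt (RatFn Qqt (Fin n))
          ((-1) ^ n / ((1 - qq) ^ n * (n.factorial : Qqt)))) *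
        ∑ i : Fin n → Fin m, (∏ α : Fin n, MvPolynomial.X (i α)) *
          MvPolynomial.C (∏ α : Fin n, ∏ β ∈ Finset.Ioi α,
            gamma (algebraMap Qqt (RatFn Qqt (Fin n)) qq) (algebraMap Qqt (RatFn Qqt (Fin n)) tt)
              (i α) (i β) (zvar Qqt α) (zvar Qqt β)) :=
  restrictX_kernel qq_ne_zero tt_ne_zero qq_pow_ne_one tt_pow_ne_one
    (fun _ => scalarProduct_self_ne_zero) m
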